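/- **Signatures, rules, stable models.** A multi-valued signature consists of finitely many constants $c$, each with a finite non-empty domain $\mathrm{Dom}(c)$; its atoms are the symbols $c=v$ with $v\in \mathrm{Dom}(c)$. An interpretation is a set of atoms. A rule $A\leftarrow B\wedge N$ has a disjunction $A$ of atoms, a conjunction $B$ of atoms and a formula $N$ in which every atom occurs under negation. $I$ is a stable model of a program if $I$ is a minimal model of the set of all $A\leftarrow B$ with $A\leftarrow B\wedge N$ in the program and $I\models N$. **${\rm LP}^{\rm MLN}$.** An ${\rm LP}^{\rm MLN}$ program $\Lambda$ is a finite set of weighted rules $w:R$ with $w\in\mathbb R$ or $w=\alpha$ (infinite weight, "hard"). Put $W_\Lambda(I)=\exp\big(\sum_{w:R\in\Lambda,\ I\models R}w\big)$ if $I$ is a stable model of $\{R\mid w:R\in\Lambda,\ I\models R\}$, and $W_\Lambda(I)=0$ otherwise; $P_\Lambda(I)=\lim_{\alpha\to\infty}W_\Lambda(I)/\sum_J W_\Lambda(J)$; and $P_\Lambda(A)=\sum_{I\models A}P_\Lambda(I)$ for a proposition $A$. **Multi-valued probabilistic programs.** Constants are divided into regular and probabilistic ones. Such a program consists of a declaration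 $p_1:c=v_1\mid\dots\mid p_n:c=v_n$ for each probabilistic $c$, with $\mathrm{Dom}(c)=\{v_1,\dots,v_n\}$, $0\le p_i\le 1$, $\sum_i p_i=1$, and of rules without probabilistic constants in their heads. It stands for the ${\rm LP}^{\rm MLN}$ program consisting of: $\ln p_i: c=v_i$ if $0<p_i<1$; $\alpha: c=v_i$ if $p_i=1$; $\alpha:\ \leftarrow c=v_i$ if $p_i=0$; $\alpha:R$ for each rule $R$; $\alpha:\bot\leftarrow c=v\wedge c=v'$ for all constants $c$ and $v\neq v'$; $\alpha:\bot\leftarrow\neg\bigvee_v c=v$ for all probabilistic $c$. **Simple P-log.** A simple P-log program $\Pi=\langle R,S,P,Obs,Act\rangle$ of signature $\sigma$ consists of: a finite set $R$ of normal rules over $\sigma$; a finite set $S$ of random selection rules $[r]\ random(c)\leftarrow B'$ with distinct identifiers $r$; a finite set $P$ of pr-atoms $pr_r(c=v\mid B)=p$ with $p\in[0,1]$; and finite sets $Obs$, $Act$ of facts $Obs(c=v)$, $Do(c=v)$. Here $B,B'$ are sets of literals (atoms $a$ or $not\ a$). The program $\tau(\Pi)$ has the atoms of $\sigma$ and the atoms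 $Intervene(c)$, $Obs(c=v)$, $Do(c=v)$ (regarded as constants with the single value $\mathbf t$); let $\sigma'$ be this signature. It consists of $R$, $Obs$, $Act$, of the rule $c=v_1;\dots;c=v_n\leftarrow B', not\ Intervene(c)$ for each rule $[r]\ random(c)\leftarrow B'$ of $S$ with $\mathrm{Dom}(c)=\{v_1,\dots,v_n\}$, and of the rules $\leftarrow Obs(c=v), not\ c=v$; $c=v\leftarrow Do(c=v)$; $Intervene(c)\leftarrow Do(c=v)$ for all atoms $c=v$ of $\sigma$. A possible world of $\Pi$ is a stable model of $\tau(\Pi)$ in which no constant has two different values; $\Pi$ is consistent if it has one. A random selection rule $r$ with body $B'$ is applied in $W$ if $W\models B'$; $c=v$ is possible in $W$ if some rule for $c$ is applied in $W$; a pr-atom $pr_r(c=v\mid B)=p$ is applied in $W$ if $W\models B$ and $r$ is applied in $W$. Standing assumptions, for every possible world $W$: at most one rule for each constant $c$ is applied in $W$ (then called $r_{W,c}$); and if a rule $r$ for $c$ is applied in $W$, any two different pr-atoms $pr_r(c=v_1\mid B_1)=p_1$, $pr_r(c=v_2\mid B_2)=p_2$ applied in $W$ have $v_1\neq v_2$ and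 $B_1=B_2$ (the common condition of the applied pr-atoms for $r_{W,c}$ and $c$ is called $B_{W,c}$). For a set $X$ of pr-atoms for $c$ with at most one pr-atom for each value, let $AV$ be the set of values $v$ such that $X$ has a pr-atom for $c=v$, let $ap(v)$ be the number $p$ of that pr-atom, and let the causal probability of $c=v$ given $X$ be $ap(v)$ if $v\in AV$ and $\big(1-\sum_{u\in AV}ap(u)\big)/|\mathrm{Dom}(c)\setminus AV|$ otherwise. For $c$ possible in a possible world $W$, let $PR_W(c)$ be $\emptyset$ if $W\models Intervene(c)$ or if no pr-atom for $r_{W,c}$ and $c$ is applied in $W$, and the set of pr-atoms $pr_{r_{W,c}}(c=v\mid B_{W,c})=p$ of $\Pi$ otherwise; let $P(W,c=v)$ be the causal probability given $PR_W(c)$. Put $$\hat\mu_\Pi(W)=\prod_{c=v\in W,\ c=v\text{ possible in }W}P(W,c=v),\quad \mu_\Pi(W)=\frac{\hat\mu_\Pi(W)}{\sum_{V\text{ possible world}}\hat\mu_\Pi(V)},\quad P_\Pi(A)=\sum_{W\text{ possible world},\ W\models A}\mu_\Pi(W).$$ **Translation.** For a rule $r$ for $c$ and a set $B$ of literals let $PR_{B,r}(c)$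 be $\emptyset$ if $Act$ contains some $Do(c=v')$, and the set of pr-atoms $pr_r(c=v\mid B)=p$ of $\Pi$ otherwise. Let $P(B,r,c=v)$ be the causal probability given $PR_{B,r}(c)$. The multi-valued probabilistic program $\Pi^{{\rm LP}^{\rm MLN}}$ has the signature $\sigma'$ extended by regular constants $Assigned_r$ with domain $\{\mathbf t\}$ and by probabilistic constants $pf^c_{B,r}$ (for $PR_{B,r}(c)\neq\emptyset$) and $pf^c_{\Box,r}$ with domain $\mathrm{Dom}(c)$. It consists of the rules of $\tau(\Pi)$ and, for each rule $[r]\ random(c)\leftarrow B'$ and each $v\in\mathrm{Dom}(c)$: - for each $B$ with $PR_{B,r}(c)\ne\emptyset$: the declaration giving $pf^c_{B,r}=v$ the probability $P(B,r,c=v)$, and the rules $c=v\leftarrow B,B',pf^c_{B,r}=v,not\ Intervene(c)$ and $Assigned_r\leftarrow B,B',not\ Intervene(c)$; - the declaration giving $pf^c_{\Box,r}=v$ the probability $1/|\mathrm{Dom}(c)|$, and the rule $c=v\leftarrow B',pf^c_{\Box,r}=v,not\ Assigned_r$. **Theorem.** Let $\Pi$ be a consistent simple P-log program of signature $\sigma$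 that satisfies the standing assumptions. Assume that some possible world $V$ has $\hat\mu_\Pi(V)\neq0$ (so that $\mu_\Pi$ is defined), and that, whenever $PR_{B,r}(c)\neq\emptyset$, this set contains at most one pr-atom for each value and its assigned probabilities sum to at most $1$, and to exactly $1$ if every value in $\mathrm{Dom}(c)$ has one (so that the declarations of $\Pi^{{\rm LP}^{\rm MLN}}$ are well-defined probability distributions). For a possible world $W$ of $\Pi$ put $$F_W=\bigwedge_{c=v\in W}c=v\ \wedge\bigwedge_{\substack{c=v\in W\text{ possible in }W\\ PR_W(c)\neq\emptyset}}pf^c_{B_{W,c},r_{W,c}}=v\ \wedge\bigwedge_{\substack{c=v\in W\text{ possible in }W\\ PR_W(c)=\emptyset}}pf^c_{\Box,r_{W,c}}=v .$$ Then $\mu_\Pi(W)=P_{\Pi^{{\rm LP}^{\rm MLN}}}(F_W)$ for every possible world $W$ of $\Pi$, and $P_\Pi(A)=P_{\Pi^{{\rm LP}^{\rm MLN}}}(A)$ for every proposition $A$ of signature $\sigma$. -/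

import Mathlib

universe u v w

namespace LPMLN

open scoped Classical
open Filter Topology

noncomputable section

/-! ## Propositional formulas, rules and stable models -/

/-- Propositional formulas over the set of atoms `A`. -/
inductive Formula (A : Type u) : Type u
  | atom (a : A)
  | falsum
  | verum
  | neg (F : Formula A)
  | and (F G : Formula A)
  | or (F G : Formula A)

namespace Formula

variable {A : Type u} {A' : Type v}

/-- Classical satisfaction; an interpretation is identified with the set of its true atoms. -/
def Sat (I : Finset A) : Formula A → Prop
  | atom a => a ∈ I
  | falsum => False
  | verum => True
  | neg F => ¬ Sat I F
  | and F G => Sat I F ∧ Sat I G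
  | or F G => Sat I F ∨ Sat I G

/-- Every occurrence of every atom is in the scope of negation. -/
def IsNegative : Formula A → Prop
  | atom _ => False
  | falsum => True
  | verum => True
  | neg _ => True
  | and F G => IsNegative F ∧ IsNegative G
  | or F G => IsNegative F ∧ IsNegative G

/-- Renaming of atoms. -/
def map (f : A → A') : Formula A → Formula A'
  | atom a => atom (f a)
  | falsum => falsum
  | verum => verum
  | neg F => neg (map f F)
  | and F G => and (map f F) (map f G)
  | or F G => or (map f F) (map f G)

/-- Finite conjunction of the formulas `f i`, `i ∈ s`. -/
def conj {ι : Type w} (s : Finset ι) (f : ι → Formula A) : Formula A :=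
  s.toList.foldr (fun i F => and (f i) F) verum

/-- Finite disjunction of the formulas `f i`, `i ∈ s`. -/
def disj {ι : Type w} (s : Finset ι) (f : ι → Formula A) : Formula A :=
  s.toList.foldr (fun i F => or (f i) F) falsum

theorem IsNegative.map {f : A → A'} : ∀ {F : Formula A}, F.IsNegative → (F.map f).IsNegative
  | atom _, h => h
  | falsum, _ => trivial
  | verum, _ => trivial
  | neg _, _ => trivial
  | and _ _, h => ⟨IsNegative.map h.1, IsNegative.map h.2⟩
  | or _ _, h => ⟨IsNegative.map h.1, IsNegative.map h.2⟩

theorem isNegative_conj_neg {ι : Type w} (s : Finset ι) (f : ι → Formula A) :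
    (conj s fun i => neg (f i)).IsNegative := by
  unfold conj
  induction s.toList with
  | nil => trivial
  | cons i l ih => exact ⟨trivial, ih⟩

theorem sat_conj {ι : Type w} (s : Finset ι) (f : ι → Formula A) (I : Finset A) :
    (conj s f).Sat I ↔ ∀ i ∈ s, (f i).Sat I := by
  have h : ∀ l : List ι, (l.foldr (fun i F => and (f i) F) verum).Sat I ↔
      ∀ i ∈ l, (f i).Sat I := by
    intro l
    induction l with
    | nil => simp [Sat]
    | cons i l ih => simp [Sat, ih]
  unfold conj
  rw [h]
  simp

theorem sat_disj {ι : Type w} (s : Finset ι) (f : ι → Formula A) (I : Finset A) :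
    (disj s f).Sat I ↔ ∃ i ∈ s, (f i).Sat I := by
  have h : ∀ l : List ι, (l.foldr (fun i F => or (f i) F) falsum).Sat I ↔
      ∃ i ∈ l, (f i).Sat I := by
    intro l
    induction l with
    | nil => simp [Sat]
    | cons i l ih => simp [Sat, ih]
  unfold disj
  rw [h]
  simp

end Formula

/-- A rule `A ← B ∧ N`: `head` is the set of disjuncts of `A`, `pos` the set of conjuncts of `B`,
and `N` is a negative formula. -/
structure Rule (A : Type u) : Type u where
  head : Finset A
  pos : Finset A
  N : Formula A
  isNegative_N : N.IsNegative

namespace Rule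

variable {A : Type u} {A' : Type v}

/-- `I` satisfies the implication `B ∧ N → A`. -/
def Sat (I : Finset A) (R : Rule A) : Prop :=
  R.pos ⊆ I → R.N.Sat I → ∃ a ∈ R.head, a ∈ I

/-- Renaming of atoms. -/
def map (f : A → A') (R : Rule A) : Rule A' where
  head := R.head.image f
  pos := R.pos.image f
  N := R.N.map f
  isNegative_N := R.isNegative_N.map

/-- The fact `a`. -/
def fact (a : A) : Rule A := ⟨{a}, ∅, .verum, trivial⟩

end Rule

/-- `J` satisfies the reduct of the program `Q` relative to `I`, which consists of `A ← B` for all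
rules `A ← B ∧ N` of `Q` such that `I` satisfies `N`. -/
def SatReduct {A : Type u} (Q : Set (Rule A)) (I J : Finset A) : Prop :=
  ∀ R ∈ Q, R.N.Sat I → R.pos ⊆ J → ∃ a ∈ R.head, a ∈ J

/-- `I` is a (deterministic) stable model of `Q`: a minimal model of the reduct of `Q` relative
to `I`. -/
def IsStableModel {A : Type u} (Q : Set (Rule A)) (I : Finset A) : Prop :=
  SatReduct Q I I ∧ ∀ J : Finset A, J ⊆ I → SatReduct Q I J → J = I

/-! ## Weighted programs -/

/-- A weight: a real number, or the symbol for the infinite weight. -/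
inductive Weight : Type
  | soft (x : ℝ)
  | hard

/-- The value of a weight when the symbol of infinite weight is given the value `α`. -/
def Weight.eval (α : ℝ) : Weight → ℝ
  | soft x => x
  | hard => α

/-- A weighted rule. -/
structure WRule (A : Type u) : Type u where
  weight : Weight
  rule : Rule A

/-- A ground weighted program: a finite set of weighted rules. -/
abbrev WProgram (A : Type u) : Type u := Finset (WRule A)

namespace WProgram

variable {A : Type u}

/-- The weighted rules whose rule is satisfied by `I`. -/
def satisfied (Q : WProgram A) (I : Finset A) : WProgram A :=
  Q.filter fun q => q.rule.Sat I

/-- The underlying unweighted program. -/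
def unweighted (Q : WProgram A) : Set (Rule A) :=
  {R | ∃ q ∈ Q, q.rule = R}

/-- `I ∈ SM[Q]`. -/
def IsSM (Q : WProgram A) (I : Finset A) : Prop :=
  IsStableModel (Q.satisfied I).unweighted I

/-- The unnormalized weight of `I`, as a function of the value `α` of the infinite weight. -/
def weight (Q : WProgram A) (α : ℝ) (I : Finset A) : ℝ :=
  if Q.IsSM I then Real.exp (∑ q ∈ Q.satisfied I, q.weight.eval α) else 0

variable [Fintype A]

/-- The quotient whose limit is the normalized weight. -/
def ratio (Q : WProgram A) (I : Finset A) (α : ℝ) : ℝ :=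
  Q.weight α I / ∑ J ∈ Finset.univ.filter (fun J : Finset A => Q.IsSM J), Q.weight α J

/-- The normalized weight (probability) of an interpretation; the limit always exists, see
`tendsto_ratio`. -/
def prob (Q : WProgram A) (I : Finset A) : ℝ := limUnder atTop (Q.ratio I)

/-- The probability of a proposition. -/
def probOf (Q : WProgram A) (F : Formula A) : ℝ :=
  ∑ I ∈ Finset.univ.filter (fun I : Finset A => F.Sat I), Q.prob I

theorem tendsto_ratio (Q : WProgram A) (I : Finset A) :
    Tendsto (Q.ratio I) atTop (𝓝 (Q.prob I)) := by
  apply tendsto_nhds_limUnder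
  by_cases hI : Q.IsSM I
  swap
  · refine ⟨0, ?_⟩
    have : Q.ratio I = fun _ => 0 := by
      funext α
      simp [ratio, weight, hI]
    rw [this]
    exact tendsto_const_nhds
  have key : ∀ s : Finset (WRule A), ∃ a b : ℝ, ∀ α, ∑ q ∈ s, q.weight.eval α = a * α + b := by
    intro s
    induction s using Finset.induction_on with
    | empty => exact ⟨0, 0, by simp⟩
    | insert q s hq ih =>
      obtain ⟨a, b, h⟩ := ih
      rcases hw : q.weight with x | _
      · exact ⟨a, b + x, fun α => by rw [Finset.sum_insert hq, h, hw, Weight.eval]; ring⟩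
      · exact ⟨a + 1, b, fun α => by rw [Finset.sum_insert hq, h, hw, Weight.eval]; ring⟩
  choose a b hab using fun J : Finset A => key (Q.satisfied J)
  set S := Finset.univ.filter (fun J : Finset A => Q.IsSM J) with hS
  have hIS : I ∈ S := by simp [hS, hI]
  have hr : Q.ratio I = fun α =>
      (∑ J ∈ S, Real.exp ((a J - a I) * α + (b J - b I)))⁻¹ := by
    funext α
    have h1 : ∀ J ∈ S, Q.weight α J = Real.exp (a J * α + b J) := by
      intro J hJ
      have : Q.IsSM J := (Finset.mem_filter.1 hJ).2
      rw [weight, if_pos this, hab]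
    rw [ratio, Finset.sum_congr rfl h1, h1 I hIS, ← inv_div, Finset.sum_div]
    congr 1
    refine Finset.sum_congr rfl fun J _ => ?_
    rw [← Real.exp_sub]
    congr 1
    ring
  rw [hr]
  by_cases hmax : ∀ J ∈ S, a J ≤ a I
  · have hlim : ∀ J ∈ S, Tendsto (fun α : ℝ => Real.exp ((a J - a I) * α + (b J - b I))) atTop
        (𝓝 (if a J = a I then Real.exp (b J - b I) else 0)) := by
      intro J hJ
      split_ifs with h
      · simp [h]
      · have hlt : a J - a I < 0 := sub_neg.2 (lt_of_le_of_ne (hmax J hJ) h)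
        exact Real.tendsto_exp_atBot.comp
          (tendsto_atBot_add_const_right _ _ (tendsto_id.const_mul_atTop_of_neg hlt))
    refine ⟨_, (tendsto_finsetSum S hlim).inv₀ ?_⟩
    apply ne_of_gt
    refine lt_of_lt_of_le zero_lt_one ?_
    have := Finset.single_le_sum
      (f := fun J => if a J = a I then Real.exp (b J - b I) else 0)
      (fun J _ => by split_ifs <;> positivity) hIS
    simpa using this
  · push Not at hmax
    obtain ⟨J, hJ, hlt⟩ := hmax
    refine ⟨0, tendsto_inv_atTop_zero.comp ?_⟩
    have h1 : Tendsto (fun α : ℝ => Real.exp ((a J - a I) * α + (b J - b I))) atTop atTop :=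
      Real.tendsto_exp_atTop.comp
        (tendsto_atTop_add_const_right _ _ (tendsto_id.const_mul_atTop (sub_pos.2 hlt)))
    refine tendsto_atTop_mono (fun α => ?_) h1
    exact Finset.single_le_sum
      (f := fun J => Real.exp ((a J - a I) * α + (b J - b I)))
      (fun _ _ => (Real.exp_pos _).le) hJ

end WProgram

/-! ## Multi-valued probabilistic programs -/

/-- The atoms `c = v` of the multi-valued signature with constants `C` and domains `Dom c`. -/
abbrev Atom (C : Type u) (Dom : C → Type v) : Type (max u v) := Σ c, Dom c

/-- No constant has two different values in `I`. -/
def UniqueValues {C : Type u} {Dom : C → Type v} (I : Finset (Atom C Dom)) : Prop :=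
  ∀ (c : C) (x y : Dom c), (⟨c, x⟩ : Atom C Dom) ∈ I → (⟨c, y⟩ : Atom C Dom) ∈ I → x = y

/-- Multi-valued probabilistic programs. `M c x` is the declared probability of `c = x` if `c` is
a probabilistic constant, and plays no role if `c` is regular. -/
structure MVProgram (C : Type u) (Dom : C → Type v) [∀ c, Fintype (Dom c)] :
    Type (max u v) where
  isProb : C → Prop
  M : (c : C) → Dom c → ℝ
  M_nonneg : ∀ c, isProb c → ∀ x, 0 ≤ M c x
  M_le_one : ∀ c, isProb c → ∀ x, M c x ≤ 1
  M_sum : ∀ c, isProb c → ∑ x, M c x = 1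
  rules : Finset (Rule (Atom C Dom))
  head_regular : ∀ R ∈ rules, ∀ a ∈ R.head, ¬ isProb a.1

namespace MVProgram

variable {C : Type u} {Dom : C → Type v} [Fintype C] [∀ c, Fintype (Dom c)]

/-- The weighted rule contributed by `p : c = x` in a declaration. -/
def declRule (p : ℝ) (a : Atom C Dom) : WRule (Atom C Dom) :=
  if p = 0 then ⟨.hard, ⟨∅, {a}, .verum, trivial⟩⟩
  else if p = 1 then ⟨.hard, .fact a⟩
  else ⟨.soft (Real.log p), .fact a⟩

/-- `⊥ ← c = x ∧ c = y`. -/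
def uniquenessRule (c : C) (x y : Dom c) : Rule (Atom C Dom) :=
  ⟨∅, {⟨c, x⟩, ⟨c, y⟩}, .verum, trivial⟩

/-- `⊥ ← ¬ ⋁ x, c = x`. -/
def existenceRule (c : C) : Rule (Atom C Dom) :=
  ⟨∅, ∅, .neg (.disj Finset.univ fun x : Dom c => .atom ⟨c, x⟩), trivial⟩

/-- The weighted program for which a multi-valued probabilistic program is shorthand. -/
def toWProgram (Q : MVProgram C Dom) : WProgram (Atom C Dom) :=
  (Finset.univ.filter fun a : Atom C Dom => Q.isProb a.1).image
      (fun a => declRule (Q.M a.1 a.2) a) ∪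
  Q.rules.image (fun R => ⟨.hard, R⟩) ∪
  (Finset.univ.filter fun t : (Σ c, Dom c × Dom c) => t.2.1 ≠ t.2.2).image
      (fun t => ⟨.hard, uniquenessRule t.1 t.2.1 t.2.2⟩) ∪
  (Finset.univ.filter fun c : C => Q.isProb c).image (fun c => ⟨.hard, existenceRule c⟩)

/-- The probability of a proposition under a multi-valued probabilistic program. -/
def probOf (Q : MVProgram C Dom) (F : Formula (Atom C Dom)) : ℝ :=
  Q.toWProgram.probOf F

end MVProgram

end

end LPMLN

namespace PLog

open scoped Classical
open LPMLN

noncomputable section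

/-! ## Simple P-log: programs -/

/-- A body `B₁, …, Bₘ, not Bₘ₊₁, …, not Bₙ`, as a set of literals. -/
@[ext]
structure Body (A : Type u) : Type u where
  pos : Finset A
  neg : Finset A

instance {A : Type u} [Fintype A] : Fintype (Body A) :=
  Fintype.ofInjective (fun B : Body A => (B.pos, B.neg)) fun B B' h => by
    ext1
    · exact congrArg Prod.fst h
    · exact congrArg Prod.snd h

namespace Body

variable {A : Type u} {A' : Type v}

/-- Satisfaction of all literals of a body. -/
def Sat (I : Finset A) (B : Body A) : Prop :=
  (∀ b ∈ B.pos, b ∈ I) ∧ ∀ b ∈ B.neg, b ∉ I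

/-- Renaming of atoms. -/
def map (f : A → A') (B : Body A) : Body A' := ⟨B.pos.image f, B.neg.image f⟩

/-- The union of two sets of literals. -/
def and (B B' : Body A) : Body A := ⟨B.pos ∪ B'.pos, B.neg ∪ B'.neg⟩

/-- The rule with the given set of head atoms and the given body. -/
def toRule (head : Finset A) (B : Body A) : Rule A where
  head := head
  pos := B.pos
  N := .conj B.neg fun b => .neg (.atom b)
  isNegative_N := Formula.isNegative_conj_neg _ _

end Body

/-- A normal rule `head ← body`. -/
structure NormalRule (A : Type u) : Type u where
  head : A
  body : Body A

/-- A random selection rule `random(const) ← body`, without its identifier. -/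
structure SelRule (C : Type u) (Dom : C → Type v) : Type (max u v) where
  const : C
  body : Body (Atom C Dom)

/-- A pr-atom `pr_rule(atom | cond) = p`. -/
structure PrAtom (C : Type u) (Dom : C → Type v) (ρ : Type w) : Type (max u v w) where
  rule : ρ
  atom : Atom C Dom
  cond : Body (Atom C Dom)
  p : Set.Icc (0 : ℝ) 1

/-- A simple P-log program; `ρ` is the set of the identifiers of its random selection rules, and
`sel r` is the rule with identifier `r`. -/
structure Program (C : Type u) (Dom : C → Type v) (ρ : Type w) : Type (max u v w) where
  R : Finset (NormalRule (Atom C Dom))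
  sel : ρ → SelRule C Dom
  pr : Finset (PrAtom C Dom ρ)
  obs : Finset (Atom C Dom)
  act : Finset (Atom C Dom)

/-! ## The answer set program of a P-log program -/

/-- The constants of the signature of `τ`: the original ones, and, with the one-element domain
`{t}`, `Intervene(c)`, `Obs(c = v)` and `Do(c = v)`. -/
inductive TauConst (C : Type u) (Dom : C → Type v) : Type (max u v)
  | orig (c : C)
  | intervene (c : C)
  | obs (a : Atom C Dom)
  | act (a : Atom C Dom)

/-- The domains of the constants of the signature of `τ`. -/
def TauDom {C : Type u} {Dom : C → Type v} : TauConst C Dom → Type v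
  | .orig c => Dom c
  | .intervene _ => PUnit
  | .obs _ => PUnit
  | .act _ => PUnit

section Signature

variable {C : Type u} {Dom : C → Type v}

instance [Fintype C] [∀ c, Fintype (Dom c)] : Fintype (TauConst C Dom) :=
  Fintype.ofSurjective
    (fun x : (C ⊕ C) ⊕ (Atom C Dom ⊕ Atom C Dom) => match x with
      | .inl (.inl c) => .orig c
      | .inl (.inr c) => .intervene c
      | .inr (.inl a) => .obs a
      | .inr (.inr a) => .act a)
    fun x => match x with
      | .orig c => ⟨.inl (.inl c), rfl⟩
      | .intervene c => ⟨.inl (.inr c), rfl⟩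
      | .obs a => ⟨.inr (.inl a), rfl⟩
      | .act a => ⟨.inr (.inr a), rfl⟩

instance [∀ c, Fintype (Dom c)] : ∀ c : TauConst C Dom, Fintype (TauDom c)
  | .orig c => inferInstanceAs (Fintype (Dom c))
  | .intervene _ => inferInstanceAs (Fintype PUnit)
  | .obs _ => inferInstanceAs (Fintype PUnit)
  | .act _ => inferInstanceAs (Fintype PUnit)

variable (C Dom) in
/-- The atoms of the signature of `τ`. -/
abbrev TauAtom : Type (max u v) := Atom (TauConst C Dom) TauDom

/-- The atom `c = v` as an atom of the signature of `τ`. -/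
def origAtom (a : Atom C Dom) : TauAtom C Dom := ⟨.orig a.1, a.2⟩

variable (Dom) in
/-- The atom `Intervene(c)`. -/
def interveneAtom (c : C) : TauAtom C Dom := ⟨.intervene c, PUnit.unit⟩

/-- The atom `Obs(c = v)`. -/
def obsAtom (a : Atom C Dom) : TauAtom C Dom := ⟨.obs a, PUnit.unit⟩

/-- The atom `Do(c = v)`. -/
def actAtom (a : Atom C Dom) : TauAtom C Dom := ⟨.act a, PUnit.unit⟩

/-- An interpretation `W` satisfies a set `B` of literals of the original signature. -/
def Holds (W : Finset (TauAtom C Dom)) (B : Body (Atom C Dom)) : Prop :=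
  (B.map origAtom).Sat W

end Signature

/-! ## Assigned, default and causal probabilities for a set of pr-atoms -/

section Causal

variable {C : Type u} {Dom : C → Type v} [∀ c, Fintype (Dom c)] {ρ : Type w}

/-- The values `v` such that `S` contains a pr-atom for `c = v`. -/
def AV (S : Finset (PrAtom C Dom ρ)) (c : C) : Finset (Dom c) :=
  Finset.univ.filter fun x => ∃ a ∈ S, a.atom = ⟨c, x⟩

/-- The assigned probability: the value `p` of the pr-atom for `c = x` in `S`. -/
def ap (S : Finset (PrAtom C Dom ρ)) (c : C) (x : Dom c) : ℝ :=
  if h : ∃ a ∈ S, a.atom = ⟨c, x⟩ then (h.choose.p : ℝ) else 0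

/-- The default probability. -/
def dp (S : Finset (PrAtom C Dom ρ)) (c : C) : ℝ :=
  (1 - ∑ x ∈ AV S c, ap S c x) / ((Finset.univ \ AV S c).card : ℝ)

/-- The causal probability. -/
def causal (S : Finset (PrAtom C Dom ρ)) (c : C) (x : Dom c) : ℝ :=
  if x ∈ AV S c then ap S c x else dp S c

theorem uniform_sum (D : Type v) [Fintype D] [Nonempty D] :
    ∑ _x : D, 1 / (Fintype.card D : ℝ) = 1 := by
  rw [Finset.sum_const, Finset.card_univ, nsmul_eq_mul]
  exact mul_one_div_cancel (Nat.cast_ne_zero.2 Fintype.card_ne_zero)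

theorem causal_nonneg (S : Finset (PrAtom C Dom ρ)) (c : C)
    (h1 : ∑ x ∈ AV S c, ap S c x ≤ 1) (x : Dom c) : 0 ≤ causal S c x := by
  unfold causal
  split_ifs
  · unfold ap
    split_ifs with h
    · exact h.choose.p.2.1
    · exact le_rfl
  · exact div_nonneg (sub_nonneg.2 h1) (Nat.cast_nonneg _)

theorem causal_sum (S : Finset (PrAtom C Dom ρ)) (c : C)
    (h2 : AV S c = Finset.univ → ∑ x ∈ AV S c, ap S c x = 1) : ∑ x, causal S c x = 1 := by
  rw [← Finset.sum_sdiff (Finset.subset_univ (AV S c))]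
  have e1 : ∑ x ∈ AV S c, causal S c x = ∑ x ∈ AV S c, ap S c x :=
    Finset.sum_congr rfl fun x hx => if_pos hx
  have e2 : ∑ x ∈ Finset.univ \ AV S c, causal S c x =
      ∑ x ∈ Finset.univ \ AV S c, dp S c :=
    Finset.sum_congr rfl fun x hx => if_neg (Finset.mem_sdiff.1 hx).2
  rw [e1, e2, Finset.sum_const, nsmul_eq_mul]
  by_cases h : (Finset.univ \ AV S c).card = 0
  · have : AV S c = Finset.univ :=
      (Finset.subset_univ _).antisymm (Finset.sdiff_eq_empty_iff_subset.1 (Finset.card_eq_zero.1 h))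
    rw [h2 this, h]
    simp
  · have h' : ((Finset.univ \ AV S c).card : ℝ) ≠ 0 := Nat.cast_ne_zero.2 h
    rw [dp, mul_div_cancel₀ _ h']
    ring

end Causal

namespace Program

variable {C : Type u} {Dom : C → Type v} {ρ : Type w}
variable [Fintype C] [∀ c, Fintype (Dom c)] [Fintype ρ]

/-- The program `τ`. -/
def tau (P : Program C Dom ρ) : Finset (Rule (TauAtom C Dom)) :=
  P.R.image (fun R => (R.body.map origAtom).toRule {origAtom R.head}) ∪
  Finset.univ.image (fun r : ρ =>
    (((P.sel r).body.map origAtom).and ⟨∅, {interveneAtom Dom (P.sel r).const}⟩).toRule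
      (Finset.univ.image fun x : Dom (P.sel r).const => origAtom ⟨(P.sel r).const, x⟩)) ∪
  P.obs.image (fun a => Rule.fact (obsAtom a)) ∪
  P.act.image (fun a => Rule.fact (actAtom a)) ∪
  Finset.univ.image (fun a : Atom C Dom => Body.toRule ∅ ⟨{obsAtom a}, {origAtom a}⟩) ∪
  Finset.univ.image (fun a : Atom C Dom => Body.toRule {origAtom a} ⟨{actAtom a}, ∅⟩) ∪
  Finset.univ.image (fun a : Atom C Dom =>
    Body.toRule {interveneAtom Dom a.1} ⟨{actAtom a}, ∅⟩)

/-- The possible worlds: the stable models of `τ`, where, the signature being multi-valued, a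
constant has at most one value. -/
def IsPossibleWorld (P : Program C Dom ρ) (W : Finset (TauAtom C Dom)) : Prop :=
  IsStableModel (P.tau : Set (Rule (TauAtom C Dom))) W ∧ UniqueValues W

/-- There is at least one possible world. -/
def Consistent (P : Program C Dom ρ) : Prop := ∃ W, P.IsPossibleWorld W

/-! ## Probabilities of possible worlds -/

/-- The random selection rule `r` is applied in `W`. -/
def Applied (P : Program C Dom ρ) (W : Finset (TauAtom C Dom)) (r : ρ) : Prop :=
  Holds W (P.sel r).body

/-- The atoms `c = v` are possible in `W`. -/
def Possible (P : Program C Dom ρ) (W : Finset (TauAtom C Dom)) (c : C) : Prop :=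
  ∃ r, (P.sel r).const = c ∧ P.Applied W r

/-- Unique random selection rule: in no possible world, two random selection rules for the same
constant are applied. -/
def UniqueSelection (P : Program C Dom ρ) : Prop :=
  ∀ W, P.IsPossibleWorld W → ∀ r r' : ρ, (P.sel r).const = (P.sel r').const →
    P.Applied W r → P.Applied W r' → r = r'

/-- Unique probability assignment: two different pr-atoms for the same rule `r` and its constant
that are applied in a possible world have different values and the same condition. -/
def UniqueAssignment (P : Program C Dom ρ) : Prop :=
  ∀ W, P.IsPossibleWorld W → ∀ r : ρ, P.Applied W r → ∀ a ∈ P.pr, ∀ b ∈ P.pr,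
    a.rule = r → b.rule = r → a.atom.1 = (P.sel r).const → b.atom.1 = (P.sel r).const →
    Holds W a.cond → Holds W b.cond → a ≠ b → a.atom ≠ b.atom ∧ a.cond = b.cond

/-- `PR_W(c)`: empty if `W` satisfies `Intervene(c)`, and otherwise the pr-atoms for `c` that
belong to the random selection rule for `c` applied in `W` and whose condition holds in `W`.
By unique probability assignment these conditions all coincide; the common one is `B_{W,c}`. -/
def PRW (P : Program C Dom ρ) (W : Finset (TauAtom C Dom)) (c : C) : Finset (PrAtom C Dom ρ) :=
  if interveneAtom Dom c ∈ W then ∅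
  else P.pr.filter fun a =>
    (P.sel a.rule).const = c ∧ P.Applied W a.rule ∧ a.atom.1 = c ∧ Holds W a.cond

/-- The unnormalized probability of a possible world. -/
def muHat (P : Program C Dom ρ) (W : Finset (TauAtom C Dom)) : ℝ :=
  ∏ a ∈ Finset.univ.filter (fun a : Atom C Dom => origAtom a ∈ W ∧ P.Possible W a.1),
    causal (P.PRW W a.1) a.1 a.2

/-- The normalized probability of a possible world. -/
def mu (P : Program C Dom ρ) (W : Finset (TauAtom C Dom)) : ℝ :=
  P.muHat W / ∑ V ∈ Finset.univ.filter (fun V => P.IsPossibleWorld V), P.muHat V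

/-- The probability of a proposition of the original signature. -/
def probOf (P : Program C Dom ρ) (F : Formula (Atom C Dom)) : ℝ :=
  ∑ W ∈ Finset.univ.filter (fun W => P.IsPossibleWorld W ∧ (F.map origAtom).Sat W), P.mu W

/-! ## The translation -/

/-- `PR_{B,r}(c)`, for the constant `c` of `r`. -/
def PRB (P : Program C Dom ρ) (B : Body (Atom C Dom)) (r : ρ) : Finset (PrAtom C Dom ρ) :=
  if ∃ x, (⟨(P.sel r).const, x⟩ : Atom C Dom) ∈ P.act then ∅
  else P.pr.filter fun a => a.rule = r ∧ a.atom.1 = (P.sel r).const ∧ a.cond = B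

/-- The pr-atoms with rule `r` and condition `B` determine a probability distribution on the
domain of the constant `c` of `r`: there is at most one for each value, and the assigned
probabilities sum to at most `1`, and to `1` if every value has an assigned probability. This is
what makes the declarations of the translation well-defined. -/
def DeclaresDistributions (P : Program C Dom ρ) : Prop :=
  ∀ (B : Body (Atom C Dom)) (r : ρ), (P.PRB B r).Nonempty →
    (∀ a ∈ P.PRB B r, ∀ b ∈ P.PRB B r, a.atom = b.atom → a.p = b.p) ∧
    ∑ x ∈ AV (P.PRB B r) (P.sel r).const, ap (P.PRB B r) (P.sel r).const x ≤ 1 ∧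
    (AV (P.PRB B r) (P.sel r).const = Finset.univ →
      ∑ x ∈ AV (P.PRB B r) (P.sel r).const, ap (P.PRB B r) (P.sel r).const x = 1)

/-- The pairs `(B, r)` such that `PR_{B,r}(c)` is not empty. -/
def PfIndex (P : Program C Dom ρ) : Type (max u v w) :=
  {x : Body (Atom C Dom) × ρ // (P.PRB x.1 x.2).Nonempty}

instance (P : Program C Dom ρ) : Fintype P.PfIndex :=
  inferInstanceAs (Fintype {x : Body (Atom C Dom) × ρ // (P.PRB x.1 x.2).Nonempty})

/-- The condition `B` of an index. -/
def PfIndex.cond {P : Program C Dom ρ} (x : P.PfIndex) : Body (Atom C Dom) := x.1.1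

/-- The random selection rule `r` of an index. -/
def PfIndex.rule {P : Program C Dom ρ} (x : P.PfIndex) : ρ := x.1.2

/-- The constants of the translation: those of `τ`, the constants `pf_{B,r}` and the default
constants `pf_{□,r}` (for the constant `c` of the rule `r`), and `Assigned_r`. -/
inductive TrConst (P : Program C Dom ρ) : Type (max u v w)
  | tau (c : TauConst C Dom)
  | pf (x : P.PfIndex)
  | pfDefault (r : ρ)
  | assigned (r : ρ)

/-- The domains of the constants of the translation. -/
def TrDom (P : Program C Dom ρ) : P.TrConst → Type v
  | .tau c => TauDom c
  | .pf x => Dom (P.sel x.rule).const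
  | .pfDefault r => Dom (P.sel r).const
  | .assigned _ => PUnit

instance (P : Program C Dom ρ) : Fintype P.TrConst :=
  Fintype.ofSurjective
    (fun x : (TauConst C Dom ⊕ P.PfIndex) ⊕ (ρ ⊕ ρ) => match x with
      | .inl (.inl c) => .tau c
      | .inl (.inr x) => .pf x
      | .inr (.inl r) => .pfDefault r
      | .inr (.inr r) => .assigned r)
    fun x => match x with
      | .tau c => ⟨.inl (.inl c), rfl⟩
      | .pf x => ⟨.inl (.inr x), rfl⟩
      | .pfDefault r => ⟨.inr (.inl r), rfl⟩
      | .assigned r => ⟨.inr (.inr r), rfl⟩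

instance (P : Program C Dom ρ) : ∀ c : P.TrConst, Fintype (P.TrDom c)
  | .tau c => inferInstanceAs (Fintype (TauDom c))
  | .pf x => inferInstanceAs (Fintype (Dom (P.sel x.rule).const))
  | .pfDefault r => inferInstanceAs (Fintype (Dom (P.sel r).const))
  | .assigned _ => inferInstanceAs (Fintype PUnit)

/-- The atoms of the signature of the translation. -/
abbrev TrAtom (P : Program C Dom ρ) : Type (max u v w) := Atom P.TrConst P.TrDom

variable (P : Program C Dom ρ)

/-- An atom of the signature of `τ` as an atom of the signature of the translation. -/
def tauToTr (a : TauAtom C Dom) : P.TrAtom := ⟨.tau a.1, a.2⟩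

/-- An atom of the original signature as an atom of the signature of the translation. -/
def origToTr (a : Atom C Dom) : P.TrAtom := P.tauToTr (origAtom a)

/-- The atom `pf_{B,r} = v`. -/
def pfAtom (x : P.PfIndex) (y : Dom (P.sel x.rule).const) : P.TrAtom := ⟨.pf x, y⟩

/-- The atom `pf_{□,r} = v`. -/
def pfDefaultAtom (r : ρ) (y : Dom (P.sel r).const) : P.TrAtom := ⟨.pfDefault r, y⟩

/-- The atom `Assigned_r`. -/
def assignedAtom (r : ρ) : P.TrAtom := ⟨.assigned r, PUnit.unit⟩

/-- The atom `Intervene(c)` for the constant `c` of the rule `r`. -/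
def interveneTr (r : ρ) : P.TrAtom := P.tauToTr (interveneAtom Dom (P.sel r).const)

/-- `c = v ← B, B', pf_{B,r} = v, not Intervene(c)`, where `B'` is the body of `r`. -/
def assignRule (x : P.PfIndex) (y : Dom (P.sel x.rule).const) : Rule P.TrAtom :=
  (((x.cond.map P.origToTr).and ((P.sel x.rule).body.map P.origToTr)).and
    ⟨{P.pfAtom x y}, {P.interveneTr x.rule}⟩).toRule {P.origToTr ⟨(P.sel x.rule).const, y⟩}

/-- `Assigned_r ← B, B', not Intervene(c)`, where `B'` is the body of `r`. -/
def assignedRule (x : P.PfIndex) : Rule P.TrAtom :=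
  (((x.cond.map P.origToTr).and ((P.sel x.rule).body.map P.origToTr)).and
    ⟨∅, {P.interveneTr x.rule}⟩).toRule {P.assignedAtom x.rule}

/-- `c = v ← B', pf_{□,r} = v, not Assigned_r`, where `B'` is the body of `r`. -/
def defaultRule (r : ρ) (y : Dom (P.sel r).const) : Rule P.TrAtom :=
  (((P.sel r).body.map P.origToTr).and ⟨{P.pfDefaultAtom r y}, {P.assignedAtom r}⟩).toRule
    {P.origToTr ⟨(P.sel r).const, y⟩}

/-- The probabilistic constants of the translation. -/
def trIsProb : P.TrConst → Prop
  | .tau _ => False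
  | .pf _ => True
  | .pfDefault _ => True
  | .assigned _ => False

/-- The declared probabilities of the translation: for `pf_{B,r} = v` the causal probability of
`c = v` with respect to `B` and `r`, for `pf_{□,r} = v` the number `1 / |Dom(c)|`. -/
def trM : (c : P.TrConst) → P.TrDom c → ℝ
  | .tau _, _ => 0
  | .pf x, y => causal (P.PRB x.cond x.rule) (P.sel x.rule).const y
  | .pfDefault r, _ => 1 / (Fintype.card (Dom (P.sel r).const) : ℝ)
  | .assigned _, _ => 0

/-- The rules of the translation. -/
def trRules : Finset (Rule P.TrAtom) :=
  P.tau.image (fun R => R.map P.tauToTr) ∪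
  Finset.univ.image
    (fun t : (Σ x : P.PfIndex, Dom (P.sel x.rule).const) => P.assignRule t.1 t.2) ∪
  Finset.univ.image (fun x : P.PfIndex => P.assignedRule x) ∪
  Finset.univ.image (fun t : (Σ r : ρ, Dom (P.sel r).const) => P.defaultRule t.1 t.2)

theorem trM_nonneg {P : Program C Dom ρ} (h : P.DeclaresDistributions) :
    ∀ c, P.trIsProb c → ∀ x, 0 ≤ P.trM c x
  | .tau _, hc, _ => hc.elim
  | .pf x, _, y => causal_nonneg _ _ (h x.cond x.rule x.2).2.1 y
  | .pfDefault _, _, _ => div_nonneg zero_le_one (Nat.cast_nonneg _)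
  | .assigned _, hc, _ => hc.elim

theorem trM_sum {P : Program C Dom ρ} [∀ c, Nonempty (Dom c)] (h : P.DeclaresDistributions) :
    ∀ c, P.trIsProb c → ∑ x, P.trM c x = 1
  | .tau _, hc => hc.elim
  | .pf x, _ =>
    causal_sum (P.PRB x.cond x.rule) (P.sel x.rule).const (h x.cond x.rule x.2).2.2
  | .pfDefault r, _ => by
    have e : ∀ y, P.trM (.pfDefault r) y = 1 / (Fintype.card (Dom (P.sel r).const) : ℝ) :=
      fun _ => rfl
    exact (Finset.sum_congr rfl fun y _ => e y).trans (uniform_sum (Dom (P.sel r).const))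
  | .assigned _, hc => hc.elim

theorem trRules_head {P : Program C Dom ρ} :
    ∀ R ∈ P.trRules, ∀ a ∈ R.head, ¬ P.trIsProb a.1 := by
  intro R hR a ha
  simp only [trRules, Finset.mem_union, Finset.mem_image, Finset.mem_univ, true_and] at hR
  rcases hR with ((⟨Q, _, rfl⟩ | ⟨t, rfl⟩) | ⟨x, rfl⟩) | ⟨t, rfl⟩
  · simp only [Rule.map, Finset.mem_image] at ha
    obtain ⟨b, _, rfl⟩ := ha
    exact id
  all_goals
    rw [Finset.mem_singleton.1 ha]
    exact id

/-- The multi-valued probabilistic program that translates `P`. -/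
def translation [∀ c, Nonempty (Dom c)] (h : P.DeclaresDistributions) :
    MVProgram P.TrConst P.TrDom where
  isProb := P.trIsProb
  M := P.trM
  M_nonneg := trM_nonneg h
  M_le_one := fun c hc x => (trM_sum h c hc) ▸
    Finset.single_le_sum (f := P.trM c) (fun y _ => trM_nonneg h c hc y) (Finset.mem_univ x)
  M_sum := trM_sum h
  rules := P.trRules
  head_regular := trRules_head

/-- The formula `F_W`: the conjunction of the atoms in `W`, of the atoms `pf_{B,r} = v` where
`c = v` is in `W` and possible in `W`, `r` is the rule for `c` applied in `W`, and `PR_W(c)` is not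
empty and `B` is the common condition of its members, and of the atoms `pf_{□,r} = v` where `c = v`
is in `W` and possible in `W`, `r` is the rule for `c` applied in `W`, and `PR_W(c)` is empty. -/
def worldFormula (W : Finset (TauAtom C Dom)) : Formula P.TrAtom :=
  .and (.conj W fun a => .atom (P.tauToTr a)) (.and
    (.conj (Finset.univ.filter fun t : (Σ x : P.PfIndex, Dom (P.sel x.rule).const) =>
        origAtom ⟨(P.sel t.1.rule).const, t.2⟩ ∈ W ∧ P.Applied W t.1.rule ∧
        ∃ a ∈ P.PRW W (P.sel t.1.rule).const, a.cond = t.1.cond)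
      fun t => .atom (P.pfAtom t.1 t.2))
    (.conj (Finset.univ.filter fun t : (Σ r : ρ, Dom (P.sel r).const) =>
        origAtom ⟨(P.sel t.1).const, t.2⟩ ∈ W ∧ P.Applied W t.1 ∧
        P.PRW W (P.sel t.1).const = ∅)
      fun t => .atom (P.pfDefaultAtom t.1 t.2)))

end Program

end

end PLog

/-!
# Simple P-log in multi-valued probabilistic programs

In the limit of infinite weight, only the stable models of the translation that satisfy all hard
rules keep a share of the probability, provided that there is one (`WProgram.prob_eq`); they are
called *full*. The soft rules that a full model satisfies are the facts `ln p : c = v` for the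
values that it gives to the probabilistic constants, so that its weight is the product of the declared
probabilities of these values (`MVProgram.limWeight_eq`).

Each full model is determined by its original part `W` and by the values `φ` of the probabilistic
constants `pf_{B,r}` and `pf_{□,r}`; the atoms `Assigned_r` follow from `W`. A pair `(W, φ)` gives a
full model exactly if `W` is a possible world, the values of the *active* probabilistic constants,
which are those that the rules of the translation copy to an original constant, agree with `W`, and
all values have non-zero probability (`exists_of_isFull`, `isFull_ofChoice`). The disjunctive
selection rules of `τ` are responsible for this equivalence: in a subset of `W` that satisfies the
reduct of `τ`, a selected constant still has a value, and as values are unique, it is the same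
value, so the additional rules of the translation impose nothing new on the subset.

In a possible world `W`, each constant that is possible in `W` has exactly one value and exactly one
active probabilistic constant, whose declared distribution is the causal probability given `PR_W(c)`
(`IsActive.pfcProb_eq`); here the standing assumptions enter. The inactive probabilistic constants
are unconstrained and sum out to `1`. Hence the full models with original part `W` have total weight
`muHat W` (`sum_limWeight_origPart_eq`), and both claims follow by summing over possible worlds
(`translation_probOf_eq`). For the formula `F_W` one also needs that no possible world properly
contains another (`IsPossibleWorld.eq_of_subset`).
-/

namespace LPMLN

open scoped Classical
open Filter Topology

noncomputable section

/-! ### Weighted programs in the limit of infinite weight -/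

/-- The finite part of a weight: the symbol of infinite weight counts as `0`. -/
def Weight.softPart : Weight → ℝ
  | soft x => x
  | hard => 0

theorem Weight.eval_eq (α : ℝ) (x : Weight) :
    x.eval α = x.softPart + if x = .hard then α else 0 := by
  cases x <;> simp [Weight.eval, Weight.softPart]

theorem satReduct_self_iff {A : Type u} {Q : Set (Rule A)} {I : Finset A} :
    SatReduct Q I I ↔ ∀ R ∈ Q, R.Sat I :=
  forall₂_congr fun _ _ => ⟨fun h a b => h b a, fun h a b => h b a⟩

namespace WProgram

variable {A : Type u}

/-- A probabilistic stable model that satisfies every hard rule. If there is such a model, these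
are the only interpretations that keep a share of the probability in the limit. -/
def IsFull (Q : WProgram A) (I : Finset A) : Prop :=
  Q.IsSM I ∧ ∀ q ∈ Q, q.weight = .hard → q.rule.Sat I

/-- The limit of the unnormalized weight after division by the weight of all hard rules: the
product of the exponentials of the soft weights for full models, and `0` otherwise. -/
def limWeight (Q : WProgram A) (I : Finset A) : ℝ :=
  if Q.IsFull I then Real.exp (∑ q ∈ Q.satisfied I, q.weight.softPart) else 0

theorem limWeight_nonneg (Q : WProgram A) (I : Finset A) : 0 ≤ Q.limWeight I := by
  unfold limWeight
  split_ifs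
  · exact (Real.exp_pos _).le
  · exact le_rfl

theorem sum_eval (Q : WProgram A) (I : Finset A) (α : ℝ) :
    ∑ q ∈ Q.satisfied I, q.weight.eval α =
      ∑ q ∈ Q.satisfied I, q.weight.softPart +
        (((Q.satisfied I).filter fun q => q.weight = .hard).card : ℝ) * α := by
  simp only [Weight.eval_eq, Finset.sum_add_distrib, ← Finset.sum_filter, Finset.sum_const,
    nsmul_eq_mul]

/-- After division by the weight of all hard rules, the weight of an interpretation converges. -/
theorem tendsto_exp_mul_weight (Q : WProgram A) (I : Finset A) :
    Tendsto (fun α => Real.exp (-((Q.filter fun q => q.weight = .hard).card : ℝ) * α) *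
      Q.weight α I) atTop (𝓝 (Q.limWeight I)) := by
  by_cases hI : Q.IsSM I
  swap
  · have : ¬ Q.IsFull I := fun h => hI h.1
    simp [weight, limWeight, hI, this]
  have hsub : ((Q.satisfied I).filter fun q => q.weight = .hard) ⊆
      Q.filter fun q => q.weight = .hard :=
    Finset.filter_subset_filter _ (Finset.filter_subset _ _)
  have e : ∀ α, Real.exp (-((Q.filter fun q => q.weight = .hard).card : ℝ) * α) * Q.weight α I =
      Real.exp (((((Q.satisfied I).filter fun q => q.weight = .hard).card : ℝ) -
        ((Q.filter fun q => q.weight = .hard).card : ℝ)) * α +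
        ∑ q ∈ Q.satisfied I, q.weight.softPart) := by
    intro α
    rw [weight, if_pos hI, sum_eval, ← Real.exp_add]
    congr 1
    ring
  simp only [e]
  by_cases hF : Q.IsFull I
  · have : ((Q.satisfied I).filter fun q => q.weight = .hard) =
        Q.filter fun q => q.weight = .hard := by
      refine hsub.antisymm fun q hq => ?_
      obtain ⟨hq, hw⟩ := Finset.mem_filter.1 hq
      exact Finset.mem_filter.2 ⟨Finset.mem_filter.2 ⟨hq, hF.2 q hq hw⟩, hw⟩
    simp [this, limWeight, hF]
  · have hlt : ((Q.satisfied I).filter fun q => q.weight = .hard).card <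
        (Q.filter fun q => q.weight = .hard).card := by
      refine Finset.card_lt_card (hsub.ssubset_of_ne fun he => hF ⟨hI, fun q hq hw => ?_⟩)
      have : q ∈ (Q.satisfied I).filter fun q => q.weight = .hard := by
        rw [he]
        exact Finset.mem_filter.2 ⟨hq, hw⟩
      exact (Finset.mem_filter.1 (Finset.mem_filter.1 this).1).2
    rw [limWeight, if_neg hF]
    refine Real.tendsto_exp_atBot.comp (tendsto_atBot_add_const_right _ _
      (tendsto_id.const_mul_atTop_of_neg (sub_neg.2 ?_)))
    exact_mod_cast hlt

variable [Fintype A]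

/-- If some stable model satisfies all hard rules, the normalized weights are the normalizations
of the limit weights. -/
theorem prob_eq (Q : WProgram A) (h : ∃ I, Q.IsFull I) (I : Finset A) :
    Q.prob I = Q.limWeight I / ∑ J, Q.limWeight J := by
  refine tendsto_nhds_unique (Q.tendsto_ratio I) ?_
  have hpos : 0 < ∑ J, Q.limWeight J := by
    obtain ⟨I₀, h₀⟩ := h
    refine Finset.sum_pos' (fun J _ => Q.limWeight_nonneg J) ⟨I₀, Finset.mem_univ _, ?_⟩
    rw [limWeight, if_pos h₀]
    exact Real.exp_pos _
  have key := (Q.tendsto_exp_mul_weight I).div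
    (tendsto_finsetSum Finset.univ fun J _ => Q.tendsto_exp_mul_weight J) hpos.ne'
  refine key.congr fun α => ?_
  have : ∑ J ∈ Finset.univ.filter (fun J : Finset A => Q.IsSM J), Q.weight α J =
      ∑ J, Q.weight α J := by
    refine Finset.sum_subset (Finset.subset_univ _) fun J _ hJ => ?_
    rw [weight, if_neg fun hs => hJ (Finset.mem_filter.2 ⟨Finset.mem_univ _, hs⟩)]
  rw [Pi.div_apply, ratio, this, ← Finset.mul_sum, mul_div_mul_left _ _ (Real.exp_pos _).ne']

end WProgram

/-! ### Multi-valued probabilistic programs -/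

namespace MVProgram

variable {C : Type u} {Dom : C → Type v}

theorem sat_fact {A : Type u} {a : A} {I : Finset A} : (Rule.fact a).Sat I ↔ a ∈ I := by
  simp [Rule.fact, Rule.Sat, Formula.Sat]

theorem sat_uniquenessRule {c : C} {x y : Dom c} {I : Finset (Atom C Dom)} :
    (uniquenessRule c x y).Sat I ↔
      ¬ ((⟨c, x⟩ : Atom C Dom) ∈ I ∧ (⟨c, y⟩ : Atom C Dom) ∈ I) := by
  simp [uniquenessRule, Rule.Sat, Finset.insert_subset_iff, Formula.Sat]

theorem declRule_zero (a : Atom C Dom) :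
    declRule 0 a = ⟨.hard, ⟨∅, {a}, .verum, trivial⟩⟩ := if_pos rfl

theorem declRule_rule {p : ℝ} (hp : p ≠ 0) (a : Atom C Dom) :
    (declRule p a).rule = .fact a := by
  unfold declRule
  rw [if_neg hp]
  split_ifs <;> rfl

theorem declRule_injective {p q : ℝ} {a b : Atom C Dom} (h : declRule p a = declRule q b) :
    a = b := by
  have h1 := congrArg (fun R => R.rule.head ∪ R.rule.pos) h
  have key : ∀ (p : ℝ) (a : Atom C Dom),
      (declRule p a).rule.head ∪ (declRule p a).rule.pos = {a} := by
    intro p a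
    unfold declRule
    split_ifs <;> simp [Rule.fact]
  simp only [key] at h1
  exact Finset.singleton_injective h1

variable [∀ c, Fintype (Dom c)]

theorem sat_existenceRule {c : C} {I : Finset (Atom C Dom)} :
    (existenceRule c : Rule (Atom C Dom)).Sat I ↔ ∃ x, (⟨c, x⟩ : Atom C Dom) ∈ I := by
  simp [existenceRule, Rule.Sat, Formula.Sat, Formula.sat_disj]

/-- `I` satisfies all rules of `Q`, gives each constant at most one value, and gives each
probabilistic constant a value, of non-zero declared probability. -/
structure IsComplete (Q : MVProgram C Dom) (I : Finset (Atom C Dom)) : Prop where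
  M_ne : ∀ a ∈ I, Q.isProb a.1 → Q.M a.1 a.2 ≠ 0
  rules : SatReduct (Q.rules : Set (Rule (Atom C Dom))) I I
  unique : UniqueValues I
  exists_mem : ∀ c, Q.isProb c → ∃ x, (⟨c, x⟩ : Atom C Dom) ∈ I

/-- If each probabilistic constant has exactly one value and this value has non-zero probability,
then a value declared with probability `1` is taken. -/
theorem IsComplete.mem_of_M_eq_one {Q : MVProgram C Dom} {I : Finset (Atom C Dom)}
    (h : Q.IsComplete I) {a : Atom C Dom} (ha : Q.isProb a.1) (h1 : Q.M a.1 a.2 = 1) :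
    a ∈ I := by
  obtain ⟨c, x⟩ := a
  obtain ⟨y, hy⟩ := h.exists_mem c ha
  by_cases hxy : y = x
  · exact hxy ▸ hy
  -- The probabilities of the other values sum to `0`, so that none of them can be taken.
  · have h2 := Finset.add_sum_erase Finset.univ (Q.M c) (Finset.mem_univ x)
    rw [Q.M_sum c ha, show Q.M c x = 1 from h1, add_eq_left,
      Finset.sum_eq_zero_iff_of_nonneg fun z _ => Q.M_nonneg c ha z] at h2
    exact (h.M_ne _ hy ha (h2 y (by simp [hxy]))).elim

variable [Fintype C]

theorem mem_toWProgram {Q : MVProgram C Dom} {q : WRule (Atom C Dom)} :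
    q ∈ Q.toWProgram ↔
      (∃ a : Atom C Dom, Q.isProb a.1 ∧ declRule (Q.M a.1 a.2) a = q) ∨
      (∃ R ∈ Q.rules, (⟨.hard, R⟩ : WRule (Atom C Dom)) = q) ∨
      (∃ c, ∃ x y : Dom c, x ≠ y ∧ ⟨.hard, uniquenessRule c x y⟩ = q) ∨
      ∃ c, Q.isProb c ∧ ⟨.hard, existenceRule c⟩ = q := by
  simp only [toWProgram, Finset.mem_union, Finset.mem_image, Finset.mem_filter, Finset.mem_univ,
    true_and, or_assoc, Sigma.exists, Prod.exists]

theorem isComplete_iff {Q : MVProgram C Dom} {I : Finset (Atom C Dom)} :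
    (∀ q ∈ Q.toWProgram, q.weight = .hard → q.rule.Sat I) ↔ Q.IsComplete I := by
  constructor
  · intro h
    refine ⟨fun a ha hp h0 => ?_, ?_, fun c x y hx hy => ?_, fun c hc => ?_⟩
    · have := h _ (mem_toWProgram.2 (.inl ⟨a, hp, rfl⟩))
      rw [h0, declRule_zero] at this
      simpa using this rfl (Finset.singleton_subset_iff.2 ha) trivial
    · exact satReduct_self_iff.2 fun R hR =>
        h _ (mem_toWProgram.2 (.inr (.inl ⟨R, hR, rfl⟩))) rfl
    · by_contra hxy
      exact sat_uniquenessRule.1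
        (h _ (mem_toWProgram.2 (.inr (.inr (.inl ⟨c, x, y, hxy, rfl⟩)))) rfl) ⟨hx, hy⟩
    · exact sat_existenceRule.1
        (h _ (mem_toWProgram.2 (.inr (.inr (.inr ⟨c, hc, rfl⟩)))) rfl)
  · intro h q hq hw
    rcases mem_toWProgram.1 hq with ⟨a, ha, rfl⟩ | ⟨R, hR, rfl⟩ | ⟨c, x, y, hxy, rfl⟩ | ⟨c, hc, rfl⟩
    · by_cases h0 : Q.M a.1 a.2 = 0
      · rw [h0, declRule_zero]
        exact fun hs _ => (h.M_ne a (Finset.singleton_subset_iff.1 hs) ha h0).elim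
      · rw [declRule_rule h0, sat_fact]
        refine h.mem_of_M_eq_one ha ?_
        by_contra h1
        simp [declRule, h0, h1] at hw
    · exact satReduct_self_iff.1 h.rules R hR
    · exact sat_uniquenessRule.2 fun hh => hxy (h.unique c x y hh.1 hh.2)
    · exact sat_existenceRule.2 (h.exists_mem c hc)

/-- For a complete interpretation `I`, the declarations contribute to the reduct exactly the
probabilistic atoms of `I` as facts, and the remaining auxiliary rules are constraints that the
subsets of `I` satisfy. -/
theorem IsComplete.satReduct_iff {Q : MVProgram C Dom} {I J : Finset (Atom C Dom)}
    (h : Q.IsComplete I) (hJ : J ⊆ I) :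
    SatReduct (Q.toWProgram.satisfied I).unweighted I J ↔
      SatReduct (Q.rules : Set (Rule (Atom C Dom))) I J ∧ ∀ a ∈ I, Q.isProb a.1 → a ∈ J := by
  constructor
  · intro hs
    refine ⟨fun R hR => ?_, fun a ha hp => ?_⟩
    · have hq : (⟨.hard, R⟩ : WRule (Atom C Dom)) ∈ Q.toWProgram :=
        mem_toWProgram.2 (.inr (.inl ⟨R, hR, rfl⟩))
      exact hs R ⟨_, Finset.mem_filter.2 ⟨hq, isComplete_iff.2 h _ hq rfl⟩, rfl⟩
    · have h0 := declRule_rule (h.M_ne a ha hp) a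
      have := hs (.fact a) ⟨declRule (Q.M a.1 a.2) a, Finset.mem_filter.2
        ⟨mem_toWProgram.2 (.inl ⟨a, hp, rfl⟩), by rw [h0, sat_fact]; exact ha⟩, h0⟩
        trivial (Finset.empty_subset _)
      simpa [Rule.fact] using this
  · rintro ⟨hs, hp⟩ _ ⟨q, hq, rfl⟩ hN hpos
    obtain ⟨hq, hsat⟩ := Finset.mem_filter.1 hq
    rcases mem_toWProgram.1 hq with ⟨a, ha, rfl⟩ | ⟨R, hR, rfl⟩ | ⟨c, x, y, hxy, rfl⟩ | ⟨c, hc, rfl⟩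
    · by_cases h0 : Q.M a.1 a.2 = 0
      · rw [h0, declRule_zero] at hpos
        exact (h.M_ne a (hJ (Finset.singleton_subset_iff.1 hpos)) ha h0).elim
      · rw [declRule_rule h0] at hsat ⊢
        exact ⟨a, Finset.mem_singleton_self a, hp a (sat_fact.1 hsat) ha⟩
    · exact hs R hR hN hpos
    · obtain ⟨b, hb, -⟩ := hsat (hpos.trans hJ) hN
      exact (Finset.notMem_empty b hb).elim
    · obtain ⟨b, hb, -⟩ := hsat (Finset.empty_subset _) hN
      exact (Finset.notMem_empty b hb).elim

/-- The full models as models of the original rules of `Q`: they are complete, and minimal among the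
models of the reduct of these rules that keep the probabilistic atoms. -/
theorem isFull_iff {Q : MVProgram C Dom} {I : Finset (Atom C Dom)} :
    Q.toWProgram.IsFull I ↔ Q.IsComplete I ∧
      ∀ J ⊆ I, SatReduct (Q.rules : Set (Rule (Atom C Dom))) I J →
        (∀ a ∈ I, Q.isProb a.1 → a ∈ J) → J = I := by
  unfold WProgram.IsFull WProgram.IsSM IsStableModel
  rw [isComplete_iff, and_comm]
  refine and_congr_right fun hc => ?_
  constructor
  · exact fun h J hJ h1 h2 => h.2 J hJ ((hc.satReduct_iff hJ).2 ⟨h1, h2⟩)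
  · refine fun h => ⟨(hc.satReduct_iff subset_rfl).2 ⟨hc.rules, fun a ha _ => ha⟩,
      fun J hJ hs => ?_⟩
    obtain ⟨h1, h2⟩ := (hc.satReduct_iff hJ).1 hs
    exact h J hJ h1 h2

/-- Only the facts `ln p : c = v` that hold in `I` contribute: their rules are distinct for distinct
atoms, hard rules have soft part `0`, and `ln 1 = 0`. -/
theorem limWeight_eq {Q : MVProgram C Dom} {I : Finset (Atom C Dom)}
    (h : Q.toWProgram.IsFull I) :
    Q.toWProgram.limWeight I =
      ∏ a ∈ Finset.univ.filter (fun a : Atom C Dom => Q.isProb a.1 ∧ a ∈ I), Q.M a.1 a.2 := by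
  have hc := (isFull_iff.1 h).1
  rw [WProgram.limWeight, if_pos h]
  have e : ∑ q ∈ Q.toWProgram.satisfied I, q.weight.softPart =
      ∑ a ∈ Finset.univ.filter (fun a : Atom C Dom => Q.isProb a.1 ∧ a ∈ I),
        Real.log (Q.M a.1 a.2) := by
    have hinj : Set.InjOn (fun a : Atom C Dom => declRule (Q.M a.1 a.2) a)
        (Finset.univ.filter (fun a : Atom C Dom => Q.isProb a.1 ∧ a ∈ I)) :=
      fun a _ b _ hab => declRule_injective hab
    have hsub : (Finset.univ.filter (fun a : Atom C Dom => Q.isProb a.1 ∧ a ∈ I)).image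
        (fun a => declRule (Q.M a.1 a.2) a) ⊆ Q.toWProgram.satisfied I := by
      intro q hq
      obtain ⟨a, ha, rfl⟩ := Finset.mem_image.1 hq
      obtain ⟨-, ha, haI⟩ := Finset.mem_filter.1 ha
      refine Finset.mem_filter.2 ⟨mem_toWProgram.2 (.inl ⟨a, ha, rfl⟩), ?_⟩
      rw [declRule_rule (hc.M_ne a haI ha), sat_fact]
      exact haI
    rw [← Finset.sum_subset hsub, Finset.sum_image hinj]
    · refine Finset.sum_congr rfl fun a ha => ?_
      obtain ⟨-, ha, haI⟩ := Finset.mem_filter.1 ha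
      unfold declRule
      rw [if_neg (hc.M_ne a haI ha)]
      split_ifs with h1
      · simp [h1, Weight.softPart]
      · rfl
    · intro q hq hq'
      obtain ⟨hq, hsat⟩ := Finset.mem_filter.1 hq
      rcases mem_toWProgram.1 hq with ⟨a, ha, rfl⟩ | ⟨R, hR, rfl⟩ | ⟨c, x, y, hxy, rfl⟩ |
        ⟨c, hc, rfl⟩
      · by_cases h0 : Q.M a.1 a.2 = 0
        · rw [h0, declRule_zero]
          rfl
        · rw [declRule_rule h0, sat_fact] at hsat
          exact (hq' (Finset.mem_image.2
            ⟨a, Finset.mem_filter.2 ⟨Finset.mem_univ _, ha, hsat⟩, rfl⟩)).elim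
      all_goals rfl
  rw [e, Real.exp_sum]
  refine Finset.prod_congr rfl fun a ha => ?_
  obtain ⟨-, ha, haI⟩ := Finset.mem_filter.1 ha
  exact Real.exp_log (lt_of_le_of_ne (Q.M_nonneg _ ha _) (hc.M_ne a haI ha).symm)

end MVProgram

end

end LPMLN

namespace PLog

open scoped Classical
open LPMLN

noncomputable section

/-! ### Reducts of rules with bodies of literals -/

/-- The body `B` of a rule survives in the reduct relative to `I`, and what remains of it there
holds in `J`. -/
def Body.RedSat {A : Type u} (I J : Finset A) (B : Body A) : Prop :=
  (∀ b ∈ B.pos, b ∈ J) ∧ ∀ b ∈ B.neg, b ∉ I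

namespace Body

variable {A : Type u} {A' : Type v}

theorem RedSat.mono {I J J' : Finset A} {B : Body A} (h : B.RedSat I J) (hJ : J ⊆ J') :
    B.RedSat I J' := ⟨fun b hb => hJ (h.1 b hb), h.2⟩

theorem RedSat.anti {I I' J : Finset A} {B : Body A} (h : B.RedSat I' J) (hI : I ⊆ I') :
    B.RedSat I J := ⟨h.1, fun b hb hb' => h.2 b hb (hI hb')⟩

theorem redSat_and {I J : Finset A} {B B' : Body A} :
    (B.and B').RedSat I J ↔ B.RedSat I J ∧ B'.RedSat I J := by
  simp only [RedSat, Body.and, Finset.mem_union, or_imp, forall_and]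
  tauto

theorem redSat_map {f : A → A'} {I J : Finset A'} {B : Body A} :
    (B.map f).RedSat I J ↔ (∀ b ∈ B.pos, f b ∈ J) ∧ ∀ b ∈ B.neg, f b ∉ I := by
  simp [RedSat, Body.map]

/-- The condition that the rule `head ← B` imposes on `J` in the reduct relative to `I`. -/
theorem toRule_red {I J : Finset A} {B : Body A} {head : Finset A} :
    ((B.toRule head).N.Sat I → (B.toRule head).pos ⊆ J → ∃ a ∈ (B.toRule head).head, a ∈ J) ↔
      (B.RedSat I J → ∃ a ∈ head, a ∈ J) := by
  have h1 : (B.toRule head).N.Sat I ↔ ∀ b ∈ B.neg, b ∉ I := by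
    simp only [toRule, Formula.sat_conj, Formula.Sat]
  rw [h1]
  exact ⟨fun h hb => h hb.2 hb.1, fun h hn hp => h ⟨hp, hn⟩⟩

end Body

/-! ### The answer set program of a P-log program -/

namespace Program

variable {C : Type u} {Dom : C → Type v} {ρ : Type w}
variable {P : Program C Dom ρ}

/-- The conditions imposed on `J` by the reduct of `τ` relative to `W`, spelled out. -/
structure TauRed (P : Program C Dom ρ) (W J : Finset (TauAtom C Dom)) : Prop where
  normal : ∀ R ∈ P.R, (R.body.map origAtom).RedSat W J → origAtom R.head ∈ J
  sel : ∀ r, ((P.sel r).body.map origAtom).RedSat W J →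
    interveneAtom Dom (P.sel r).const ∉ W →
    ∃ x, origAtom (⟨(P.sel r).const, x⟩ : Atom C Dom) ∈ J
  obs : ∀ a ∈ P.obs, obsAtom a ∈ J
  act : ∀ a ∈ P.act, actAtom a ∈ J
  obs_constraint : ∀ a, obsAtom a ∈ J → origAtom a ∈ W
  orig_of_act : ∀ a, actAtom a ∈ J → origAtom a ∈ J
  intervene_of_act : ∀ a : Atom C Dom, actAtom a ∈ J → interveneAtom Dom a.1 ∈ J

/-- Negative literals are antitone, so a larger interpretation has a smaller reduct. -/
theorem TauRed.anti {W W' J : Finset (TauAtom C Dom)} (h : P.TauRed W J) (hW : W ⊆ W') :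
    P.TauRed W' J where
  normal R hR hB := h.normal R hR (hB.anti hW)
  sel r hB hi := h.sel r (hB.anti hW) fun hi' => hi (hW hi')
  obs := h.obs
  act := h.act
  obs_constraint a ha := hW (h.obs_constraint a ha)
  orig_of_act := h.orig_of_act
  intervene_of_act := h.intervene_of_act

/-- The part of `W` in which the atoms `Do(c = v)` and `Intervene(c)` are supported by facts. -/
def supported (P : Program C Dom ρ) (W : Finset (TauAtom C Dom)) : Finset (TauAtom C Dom) :=
  W.filter fun a => match a with
    | ⟨.orig _, _⟩ => True
    | ⟨.obs _, _⟩ => True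
    | ⟨.act a, _⟩ => a ∈ P.act
    | ⟨.intervene c, _⟩ => ∃ x, (⟨c, x⟩ : Atom C Dom) ∈ P.act

theorem origAtom_mem_supported {W : Finset (TauAtom C Dom)} {a : Atom C Dom} :
    origAtom a ∈ P.supported W ↔ origAtom a ∈ W := by
  simp [supported, origAtom]

theorem intervene_mem_supported {W : Finset (TauAtom C Dom)} {c : C} :
    interveneAtom Dom c ∈ P.supported W ↔
      interveneAtom Dom c ∈ W ∧ ∃ x, (⟨c, x⟩ : Atom C Dom) ∈ P.act := by
  simp [supported, interveneAtom]

/-- Omitting the unsupported atoms `Do(c = v)` and `Intervene(c)` preserves the reduct of `τ`, since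
these atoms are derived only from facts and from each other. -/
theorem TauRed.supported {W : Finset (TauAtom C Dom)} (h : P.TauRed W W) :
    P.TauRed W (P.supported W) := by
  have hs : P.supported W ⊆ W := Finset.filter_subset _ _
  have hact : ∀ a : Atom C Dom, actAtom a ∈ P.supported W ↔ actAtom a ∈ W ∧ a ∈ P.act := by
    simp [Program.supported, actAtom]
  refine ⟨fun R hR hB => ?_, fun r hB hi => ?_, fun a ha => ?_, fun a ha => ?_, fun a ha => ?_,
      fun a ha => ?_, fun a ha => ?_⟩
  · exact origAtom_mem_supported.2 (h.normal R hR (hB.mono hs))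
  · simpa only [origAtom_mem_supported] using h.sel r (hB.mono hs) hi
  · have := h.obs a ha
    simpa [Program.supported, obsAtom] using this
  · exact (hact a).2 ⟨h.act a ha, ha⟩
  · exact h.obs_constraint a (hs ha)
  · exact origAtom_mem_supported.2 (h.orig_of_act a (hs ha))
  · exact intervene_mem_supported.2 ⟨h.intervene_of_act a (hs ha), a.2, ((hact a).1 ha).2⟩

variable [Fintype C] [∀ c, Fintype (Dom c)] [Fintype ρ]

theorem satReduct_tau_iff {W J : Finset (TauAtom C Dom)} :
    SatReduct (P.tau : Set (Rule (TauAtom C Dom))) W J ↔ P.TauRed W J := by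
  have e : SatReduct (P.tau : Set (Rule (TauAtom C Dom))) W J ↔
      ∀ R ∈ P.tau, (R.N.Sat W → R.pos ⊆ J → ∃ a ∈ R.head, a ∈ J) := Iff.rfl
  rw [e]
  simp only [tau, Finset.forall_mem_union, Finset.forall_mem_image, Body.toRule_red,
    Body.redSat_and]
  constructor
  · rintro ⟨⟨⟨⟨⟨⟨h1, h2⟩, h3⟩, h4⟩, h5⟩, h6⟩, h7⟩
    refine ⟨fun R hR hB => ?_, fun r hB hi => ?_, fun a ha => ?_, fun a ha => ?_, fun a ha => ?_,
      fun a ha => ?_, fun a ha => ?_⟩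
    · simpa using h1 hR hB
    · simpa using h2 (Finset.mem_univ r) ⟨hB, by simpa [Body.RedSat] using hi⟩
    · simpa [Rule.fact, Formula.Sat] using h3 ha
    · simpa [Rule.fact, Formula.Sat] using h4 ha
    · by_contra hW
      simpa using h5 (Finset.mem_univ a) (by simp [Body.RedSat, ha, hW])
    · simpa using h6 (Finset.mem_univ a) (by simp [Body.RedSat, ha])
    · simpa using h7 (Finset.mem_univ a) (by simp [Body.RedSat, ha])
  · rintro ⟨h1, h2, h3, h4, h5, h6, h7⟩
    refine ⟨⟨⟨⟨⟨⟨fun R hR hB => ?_, fun r _ hB => ?_⟩, fun a ha => ?_⟩, fun a ha => ?_⟩,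
      fun a _ ha => ?_⟩, fun a _ ha => ?_⟩, fun a _ ha => ?_⟩
    · simpa using h1 R hR hB
    · simpa using h2 r hB.1 (by simpa [Body.RedSat] using hB.2)
    · simpa [Rule.fact, Formula.Sat] using h3 a ha
    · simpa [Rule.fact, Formula.Sat] using h4 a ha
    · simp only [Body.RedSat, Finset.mem_singleton, forall_eq] at ha
      exact (ha.2 (h5 a ha.1)).elim
    · simp only [Body.RedSat, Finset.mem_singleton, forall_eq] at ha
      simpa using h6 a ha.1
    · simp only [Body.RedSat, Finset.mem_singleton, forall_eq] at ha
      simpa using h7 a ha.1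

theorem isPossibleWorld_iff {W : Finset (TauAtom C Dom)} :
    P.IsPossibleWorld W ↔
      (P.TauRed W W ∧ ∀ J ⊆ W, P.TauRed W J → J = W) ∧ UniqueValues W := by
  unfold IsPossibleWorld IsStableModel
  simp only [satReduct_tau_iff]

/-- Possible worlds form an antichain. -/
theorem IsPossibleWorld.eq_of_subset {W W' : Finset (TauAtom C Dom)} (h : P.IsPossibleWorld W)
    (h' : P.IsPossibleWorld W') (hW : W ⊆ W') : W = W' := by
  rw [isPossibleWorld_iff] at h h'
  exact h'.1.2 W hW (h.1.1.anti hW)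

/-- In a possible world, the interventions are those that the facts `Do(c = v)` of the program
demand. This reconciles the case distinctions in `PRW` and `PRB`. -/
theorem IsPossibleWorld.intervene_iff {W : Finset (TauAtom C Dom)} (h : P.IsPossibleWorld W)
    {c : C} : interveneAtom Dom c ∈ W ↔ ∃ x, (⟨c, x⟩ : Atom C Dom) ∈ P.act := by
  rw [isPossibleWorld_iff] at h
  constructor
  · intro hi
    rw [← h.1.2 _ (Finset.filter_subset _ _) h.1.1.supported] at hi
    exact (intervene_mem_supported.1 hi).2
  · rintro ⟨x, hx⟩
    exact h.1.1.intervene_of_act ⟨c, x⟩ (h.1.1.act _ hx)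

end Program

namespace Program

variable {C : Type u} {Dom : C → Type v} {ρ : Type w} [∀ c, Fintype (Dom c)]

/-! ### Random constants and their values -/

/-- The probabilistic constants of the translation: `inl x` stands for `pf_{B,r}`, where
`x = (B, r)`, and `inr r` for `pf_{□,r}`. -/
abbrev PfConst (P : Program C Dom ρ) : Type (max u v w) := P.PfIndex ⊕ ρ

/-- The random selection rule to which a probabilistic constant belongs. -/
def PfConst.rule {P : Program C Dom ρ} : P.PfConst → ρ
  | .inl x => x.rule
  | .inr r => r

/-- The original constant whose value a probabilistic constant determines. -/
abbrev PfConst.const {P : Program C Dom ρ} (k : P.PfConst) : C := (P.sel k.rule).const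

/-- The atom of the translation that gives the probabilistic constant `k` the value `y`. -/
def pfcAtom (P : Program C Dom ρ) : (k : P.PfConst) → Dom k.const → P.TrAtom
  | .inl x, y => P.pfAtom x y
  | .inr r, y => P.pfDefaultAtom r y

variable {P : Program C Dom ρ}

/-- The body of the rule with head `Assigned_r` that belongs to `x = (B, r)` holds in `W`. -/
def IsAssigning (W : Finset (TauAtom C Dom)) (x : P.PfIndex) : Prop :=
  Holds W x.cond ∧ P.Applied W x.rule ∧ interveneAtom Dom (P.sel x.rule).const ∉ W

variable (P) in
/-- `Assigned_r` is derived if the original part of the interpretation is `W`. -/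
def IsAssigned (W : Finset (TauAtom C Dom)) (r : ρ) : Prop :=
  ∃ x : P.PfIndex, x.rule = r ∧ IsAssigning W x

/-- The value of the probabilistic constant is copied to its original constant, if the original
part of the interpretation is `W`. -/
def IsActive (W : Finset (TauAtom C Dom)) : P.PfConst → Prop
  | .inl x => IsAssigning W x
  | .inr r => P.Applied W r ∧ ¬ P.IsAssigned W r

theorem IsActive.applied {W : Finset (TauAtom C Dom)} :
    ∀ {k : P.PfConst}, IsActive W k → P.Applied W k.rule
  | .inl _, h => h.2.1
  | .inr _, h => h.1

/-- The values chosen by `φ` for the probabilistic constants agree with those that `W` gives to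
the original constants. -/
def Agrees (W : Finset (TauAtom C Dom)) (φ : (k : P.PfConst) → Dom k.const) : Prop :=
  ∀ k, IsActive W k → origAtom (⟨k.const, φ k⟩ : Atom C Dom) ∈ W

variable [Fintype C]

/-- The original part of an interpretation of the signature of the translation. -/
def origPart (I : Finset P.TrAtom) : Finset (TauAtom C Dom) :=
  Finset.univ.filter fun a => P.tauToTr a ∈ I

theorem mem_origPart {I : Finset P.TrAtom} {a : TauAtom C Dom} :
    a ∈ origPart I ↔ P.tauToTr a ∈ I := by
  simp [origPart]

theorem origPart_mono {I J : Finset P.TrAtom} (h : I ⊆ J) : origPart I ⊆ origPart J :=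
  fun _ ha => mem_origPart.2 (h (mem_origPart.1 ha))

theorem eq_of_atoms {I J : Finset P.TrAtom} (h1 : origPart I = origPart J)
    (h2 : ∀ k y, P.pfcAtom k y ∈ I ↔ P.pfcAtom k y ∈ J)
    (h3 : ∀ r, P.assignedAtom r ∈ I ↔ P.assignedAtom r ∈ J) : I = J := by
  ext ⟨c, y⟩
  cases c with
  | tau c =>
    have := Finset.ext_iff.1 h1 ⟨c, y⟩
    rwa [mem_origPart, mem_origPart] at this
  | pf x => exact h2 (.inl x) y
  | pfDefault r => exact h2 (.inr r) y
  | assigned r => exact h3 r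

theorem redSat_map_tauToTr {I J : Finset P.TrAtom} {B : Body (Atom C Dom)} :
    (B.map P.origToTr).RedSat I J ↔
      (B.map origAtom).RedSat (origPart I) (origPart J) := by
  simp only [Body.redSat_map, mem_origPart, origToTr]

theorem sat_map_tauToTr {I : Finset P.TrAtom} :
    ∀ {F : Formula (TauAtom C Dom)}, (F.map P.tauToTr).Sat I ↔ F.Sat (origPart I)
  | .atom _ => mem_origPart.symm
  | .falsum => Iff.rfl
  | .verum => Iff.rfl
  | .neg F => not_congr (sat_map_tauToTr (F := F))
  | .and F G => and_congr (sat_map_tauToTr (F := F)) (sat_map_tauToTr (F := G))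
  | .or F G => or_congr (sat_map_tauToTr (F := F)) (sat_map_tauToTr (F := G))

variable [Fintype ρ]

/-- The interpretation of the signature of the translation determined by its original part `W`
and by the values `φ` of the probabilistic constants. -/
def ofChoice (W : Finset (TauAtom C Dom)) (φ : (k : P.PfConst) → Dom k.const) :
    Finset P.TrAtom :=
  Finset.univ.filter fun a => match a with
    | ⟨.tau c, y⟩ => (⟨c, y⟩ : TauAtom C Dom) ∈ W
    | ⟨.pf x, y⟩ => φ (.inl x) = y
    | ⟨.pfDefault r, y⟩ => φ (.inr r) = y
    | ⟨.assigned r, _⟩ => P.IsAssigned W r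

section ofChoice

variable {W : Finset (TauAtom C Dom)} {φ : (k : P.PfConst) → Dom k.const}

theorem tauToTr_mem_ofChoice {a : TauAtom C Dom} : P.tauToTr a ∈ ofChoice W φ ↔ a ∈ W := by
  simp [ofChoice, tauToTr]

theorem pfcAtom_mem_ofChoice {k : P.PfConst} {y : Dom k.const} :
    P.pfcAtom k y ∈ ofChoice W φ ↔ φ k = y := by
  rcases k with x | r <;> simp [ofChoice, pfcAtom, pfAtom, pfDefaultAtom]

theorem assignedAtom_mem_ofChoice {r : ρ} :
    P.assignedAtom r ∈ ofChoice W φ ↔ P.IsAssigned W r := by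
  simp [ofChoice, assignedAtom]

theorem origPart_ofChoice : origPart (ofChoice W φ) = W := by
  ext a
  rw [mem_origPart, tauToTr_mem_ofChoice]

theorem ofChoice_injective (W : Finset (TauAtom C Dom)) :
    Function.Injective fun φ : (k : P.PfConst) → Dom k.const => ofChoice W φ := by
  intro φ ψ h
  funext k
  have : P.pfcAtom k (ψ k) ∈ ofChoice W φ := by
    rw [show ofChoice W φ = ofChoice W ψ from h, pfcAtom_mem_ofChoice]
  exact pfcAtom_mem_ofChoice.1 this

end ofChoice

/-! ### The reduct of the translation -/

/-- The conditions imposed on `J` by the reduct of the translation relative to `I`, in terms of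
the original parts of `I` and `J`. -/
structure TrRed (I J : Finset P.TrAtom) : Prop where
  tau : P.TauRed (origPart I) (origPart J)
  assign : ∀ (x : P.PfIndex) (y : Dom (P.sel x.rule).const),
    (x.cond.map origAtom).RedSat (origPart I) (origPart J) →
    ((P.sel x.rule).body.map origAtom).RedSat (origPart I) (origPart J) →
    interveneAtom Dom (P.sel x.rule).const ∉ origPart I →
    P.pfAtom x y ∈ J → origAtom (⟨(P.sel x.rule).const, y⟩ : Atom C Dom) ∈ origPart J
  assigned : ∀ x : P.PfIndex,
    (x.cond.map origAtom).RedSat (origPart I) (origPart J) →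
    ((P.sel x.rule).body.map origAtom).RedSat (origPart I) (origPart J) →
    interveneAtom Dom (P.sel x.rule).const ∉ origPart I → P.assignedAtom x.rule ∈ J
  default : ∀ (r : ρ) (y : Dom (P.sel r).const),
    ((P.sel r).body.map origAtom).RedSat (origPart I) (origPart J) →
    P.assignedAtom r ∉ I → P.pfDefaultAtom r y ∈ J →
    origAtom (⟨(P.sel r).const, y⟩ : Atom C Dom) ∈ origPart J

theorem satReduct_tau_map {I J : Finset P.TrAtom} :
    (∀ R ∈ P.tau, (R.map P.tauToTr).N.Sat I → (R.map P.tauToTr).pos ⊆ J →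
      ∃ a ∈ (R.map P.tauToTr).head, a ∈ J) ↔ P.TauRed (origPart I) (origPart J) := by
  rw [← satReduct_tau_iff]
  refine forall₂_congr fun R _ => ?_
  simp only [Rule.map, sat_map_tauToTr, Finset.image_subset_iff, Finset.exists_mem_image]
  simp only [← mem_origPart]
  rfl

theorem satReduct_trRules_iff {I J : Finset P.TrAtom} :
    SatReduct (P.trRules : Set (Rule P.TrAtom)) I J ↔ TrRed I J := by
  have e : SatReduct (P.trRules : Set (Rule P.TrAtom)) I J ↔
      ∀ R ∈ P.trRules, (R.N.Sat I → R.pos ⊆ J → ∃ a ∈ R.head, a ∈ J) := Iff.rfl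
  rw [e]
  simp only [trRules, Finset.forall_mem_union, Finset.forall_mem_image, satReduct_tau_map,
    assignRule, assignedRule, defaultRule, Body.toRule_red, Body.redSat_and, redSat_map_tauToTr,
    Finset.mem_univ, forall_true_left, Sigma.forall]
  simp only [Body.RedSat, Finset.mem_singleton, forall_eq, exists_eq_left, Finset.notMem_empty,
    IsEmpty.forall_iff, implies_true, true_and, interveneTr, origToTr, ← mem_origPart]
  constructor
  · rintro ⟨⟨⟨h1, h2⟩, h3⟩, h4⟩
    exact ⟨h1, fun x y a b c d => h2 x y ⟨⟨a, b⟩, d, c⟩, fun x a b c => h3 ⟨⟨a, b⟩, c⟩,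
      fun r y a b c => h4 r y ⟨a, c, b⟩⟩
  · rintro ⟨h1, h2, h3, h4⟩
    exact ⟨⟨⟨h1, fun x y h => h2 x y h.1.1 h.1.2 h.2.2 h.2.1⟩,
      fun x h => h3 x h.1.1 h.1.2 h.2⟩, fun r y h => h4 r y h.1 h.2.2 h.2.1⟩

end Program

namespace Program

variable {C : Type u} {Dom : C → Type v} {ρ : Type w} [∀ c, Fintype (Dom c)]
variable {P : Program C Dom ρ}

/-! ### Stable models of the translation -/

variable (P) in
/-- The declared probability of the value `y` of the probabilistic constant `k`. -/
def pfcProb : (k : P.PfConst) → Dom k.const → ℝ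
  | .inl x, y => causal (P.PRB x.cond x.rule) (P.sel x.rule).const y
  | .inr r, _ => 1 / (Fintype.card (Dom (P.sel r).const) : ℝ)

theorem trM_pfcAtom :
    ∀ (k : P.PfConst) (y : Dom k.const), P.trM (P.pfcAtom k y).1 (P.pfcAtom k y).2 = P.pfcProb k y
  | .inl _, _ => rfl
  | .inr _, _ => rfl

theorem trIsProb_iff {a : P.TrAtom} : P.trIsProb a.1 ↔ ∃ k y, P.pfcAtom k y = a := by
  constructor
  · obtain ⟨c | x | r | r, y⟩ := a
    · exact fun h => h.elim
    · exact fun _ => ⟨.inl x, y, rfl⟩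
    · exact fun _ => ⟨.inr r, y, rfl⟩
    · exact fun h => h.elim
  · rintro ⟨x | r, y, rfl⟩
    · exact trivial
    · exact trivial

theorem pfcAtom_injective {k k' : P.PfConst} {y : Dom k.const} {y' : Dom k'.const}
    (h : P.pfcAtom k y = P.pfcAtom k' y') : k = k' := by
  rcases k with x | r <;> rcases k' with x' | r' <;> cases h <;> rfl

variable [Fintype C]

/-- The interpretation obtained from `I` by replacing its original part by a subset `J` of it and
by removing the unsupported atoms `Assigned_r`. -/
def shrink (I : Finset P.TrAtom) (J : Finset (TauAtom C Dom)) : Finset P.TrAtom :=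
  I.filter fun a => match a with
    | ⟨.tau c, y⟩ => (⟨c, y⟩ : TauAtom C Dom) ∈ J
    | ⟨.pf _, _⟩ => True
    | ⟨.pfDefault _, _⟩ => True
    | ⟨.assigned r, _⟩ => P.IsAssigned (origPart I) r

theorem origPart_shrink {I : Finset P.TrAtom} {J : Finset (TauAtom C Dom)}
    (hJ : J ⊆ origPart I) : origPart (shrink I J) = J := by
  ext a
  have := @hJ a
  rw [mem_origPart] at this
  rw [mem_origPart]
  simp only [shrink, tauToTr, Finset.mem_filter] at this ⊢
  exact ⟨fun h => h.2, fun h => ⟨this h, h⟩⟩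

theorem pfcAtom_mem_shrink {I : Finset P.TrAtom} {J : Finset (TauAtom C Dom)} {k : P.PfConst}
    {y : Dom k.const} : P.pfcAtom k y ∈ shrink I J ↔ P.pfcAtom k y ∈ I := by
  rcases k with x | r <;> simp [shrink, pfcAtom, pfAtom, pfDefaultAtom]

theorem assignedAtom_mem_shrink {I : Finset P.TrAtom} {J : Finset (TauAtom C Dom)} {r : ρ} :
    P.assignedAtom r ∈ shrink I J ↔ P.assignedAtom r ∈ I ∧ P.IsAssigned (origPart I) r := by
  simp [shrink, assignedAtom]

/-- If `J` satisfies the reduct of `τ` and keeps the values of the selected constants, then the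
reduced interpretation satisfies the reduct of the translation. -/
theorem TrRed.shrink {I : Finset P.TrAtom} (h : TrRed I I) {J : Finset (TauAtom C Dom)}
    (hJ : J ⊆ origPart I) (htau : P.TauRed (origPart I) J)
    (hvalue : ∀ (r : ρ) (y : Dom (P.sel r).const),
      ((P.sel r).body.map origAtom).RedSat (origPart I) J →
      origAtom (⟨(P.sel r).const, y⟩ : Atom C Dom) ∈ origPart I →
      origAtom (⟨(P.sel r).const, y⟩ : Atom C Dom) ∈ J) :
    TrRed I (Program.shrink I J) := by
  refine ⟨?_, ?_, ?_, ?_⟩ <;> rw [origPart_shrink hJ]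
  · exact htau
  · intro x y h1 h2 h3 h4
    exact hvalue _ y h2 (h.assign x y (h1.mono hJ) (h2.mono hJ) h3
      ((pfcAtom_mem_shrink (k := .inl x)).1 h4))
  · intro x h1 h2 h3
    exact assignedAtom_mem_shrink.2 ⟨h.assigned x (h1.mono hJ) (h2.mono hJ) h3,
      x, rfl, h1.mono hJ, h2.mono hJ, h3⟩
  · intro r y h1 h2 h3
    exact hvalue r y h1 (h.default r y (h1.mono hJ) h2 ((pfcAtom_mem_shrink (k := .inr r)).1 h3))

variable [Fintype ρ]

theorem trRed_ofChoice {W : Finset (TauAtom C Dom)} {φ : (k : P.PfConst) → Dom k.const}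
    (hW : P.TauRed W W) (hφ : Agrees W φ) : TrRed (ofChoice W φ) (ofChoice W φ) := by
  refine ⟨?_, ?_, ?_, ?_⟩ <;> rw [origPart_ofChoice]
  · exact hW
  · intro x y h1 h2 h3 h4
    rw [← (pfcAtom_mem_ofChoice (k := .inl x)).1 h4]
    exact hφ (.inl x) ⟨h1, h2, h3⟩
  · exact fun x h1 h2 h3 => assignedAtom_mem_ofChoice.2 ⟨x, rfl, h1, h2, h3⟩
  · intro r y h1 h2 h3
    rw [← (pfcAtom_mem_ofChoice (k := .inr r)).1 h3]
    exact hφ (.inr r) ⟨h1, fun h => h2 (assignedAtom_mem_ofChoice.2 h)⟩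

theorem uniqueValues_ofChoice {W : Finset (TauAtom C Dom)} {φ : (k : P.PfConst) → Dom k.const}
    (hW : UniqueValues W) : UniqueValues (ofChoice W φ) := by
  rintro (c | x | r | r) y z hy hz
  · exact hW c y z (tauToTr_mem_ofChoice (a := ⟨c, y⟩).1 hy)
      (tauToTr_mem_ofChoice (a := ⟨c, z⟩).1 hz)
  · exact ((pfcAtom_mem_ofChoice (k := .inl x)).1 hy).symm.trans
      ((pfcAtom_mem_ofChoice (k := .inl x)).1 hz)
  · exact ((pfcAtom_mem_ofChoice (k := .inr r)).1 hy).symm.trans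
      ((pfcAtom_mem_ofChoice (k := .inr r)).1 hz)
  · rfl

variable [∀ c, Nonempty (Dom c)]

/-- A full stable model of the translation consists of a possible world, of values of the
probabilistic constants that agree with it, and of the atoms `Assigned_r` derived from it.

Removing the unsupported atoms `Do(c = v)` and `Intervene(c)` from a full stable model first shows
that `Intervene(c)` holds only if some `Do(c = v)` is a fact. Hence, in any further reduction of the
original part, a selected constant keeps some value, and by uniqueness it is the same value. -/
theorem exists_of_isFull {hdecl : P.DeclaresDistributions} {I : Finset P.TrAtom}
    (hI : (P.translation hdecl).toWProgram.IsFull I) :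
    ∃ W φ, P.IsPossibleWorld W ∧ Agrees W φ ∧ (∀ k, P.pfcProb k (φ k) ≠ 0) ∧
      ofChoice W φ = I := by
  obtain ⟨hc, hmin⟩ := MVProgram.isFull_iff.1 hI
  have hred : TrRed I I := satReduct_trRules_iff.1 hc.rules
  have hex : ∀ k : P.PfConst, ∃ y, P.pfcAtom k y ∈ I := by
    rintro (x | r)
    · exact hc.exists_mem (.pf x) trivial
    · exact hc.exists_mem (.pfDefault r) trivial
  choose φ hφ using hex
  have hφ' : ∀ k y, φ k = y ↔ P.pfcAtom k y ∈ I := by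
    refine fun k y => ⟨fun h => h ▸ hφ k, fun h => ?_⟩
    rcases k with x | r
    · exact hc.unique (.pf x) _ _ (hφ (.inl x)) h
    · exact hc.unique (.pfDefault r) _ _ (hφ (.inr r)) h
  have huniq : UniqueValues (origPart I) := fun c x y hx hy =>
    hc.unique (.tau c) x y (mem_origPart.1 hx) (mem_origPart.1 hy)
  have key : ∀ J ⊆ origPart I, P.TauRed (origPart I) J →
      (∀ (r : ρ) (y : Dom (P.sel r).const),
        ((P.sel r).body.map origAtom).RedSat (origPart I) J →
        origAtom (⟨(P.sel r).const, y⟩ : Atom C Dom) ∈ origPart I →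
        origAtom (⟨(P.sel r).const, y⟩ : Atom C Dom) ∈ J) → shrink I J = I := by
    intro J hJ htau hvalue
    refine hmin _ (Finset.filter_subset _ _)
      (satReduct_trRules_iff.2 (hred.shrink hJ htau hvalue)) fun a ha hp => ?_
    obtain ⟨k, y, rfl⟩ := trIsProb_iff.1 hp
    exact pfcAtom_mem_shrink.2 ha
  -- All values are kept, so the unsupported atoms can be removed; this needs no information about
  -- interventions yet.
  have hsub : P.supported (origPart I) ⊆ origPart I := Finset.filter_subset _ _
  have hsupp := key _ hsub hred.tau.supported fun r y _ hy => origAtom_mem_supported.2 hy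
  have hint : ∀ c, interveneAtom Dom c ∈ origPart I → ∃ x, (⟨c, x⟩ : Atom C Dom) ∈ P.act := by
    intro c hi
    have h1 := congrArg origPart hsupp
    rw [origPart_shrink hsub] at h1
    rw [← h1] at hi
    exact (intervene_mem_supported.1 hi).2
  have hassigned : ∀ r, P.assignedAtom r ∈ I ↔ P.IsAssigned (origPart I) r := by
    refine fun r => ⟨fun h => ?_, ?_⟩
    · rw [← hsupp] at h
      exact (assignedAtom_mem_shrink.1 h).2
    · rintro ⟨x, rfl, h1, h2, h3⟩
      exact hred.assigned x h1 h2 h3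
  refine ⟨origPart I, φ, isPossibleWorld_iff.2 ⟨⟨hred.tau, fun J hJ htau => ?_⟩, huniq⟩, ?_, ?_, ?_⟩
  · rw [← origPart_shrink hJ]
    refine congrArg origPart (key J hJ htau fun r y hr hy => ?_)
    -- The selected constant has a value in `J`, which must be the one that it has in `I`.
    obtain ⟨z, hz⟩ : ∃ z, origAtom (⟨(P.sel r).const, z⟩ : Atom C Dom) ∈ J := by
      by_cases hi : interveneAtom Dom (P.sel r).const ∈ origPart I
      · obtain ⟨z, hz⟩ := hint _ hi
        exact ⟨z, htau.orig_of_act _ (htau.act _ hz)⟩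
      · exact htau.sel r hr hi
    have : z = y := huniq (.orig (P.sel r).const) z y (hJ hz) hy
    exact this ▸ hz
  · rintro (x | r) hk
    · exact hred.assign x _ hk.1 hk.2.1 hk.2.2 (hφ (.inl x))
    · exact hred.default r _ hk.1 (fun h => hk.2 ((hassigned r).1 h)) (hφ (.inr r))
  · intro k
    rw [← trM_pfcAtom]
    exact hc.M_ne _ (hφ k) (trIsProb_iff.2 ⟨k, _, rfl⟩)
  · refine eq_of_atoms origPart_ofChoice (fun k y => ?_) fun r => ?_
    · rw [pfcAtom_mem_ofChoice, hφ']
    · rw [assignedAtom_mem_ofChoice, hassigned]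

/-- The converse of `exists_of_isFull`. -/
theorem isFull_ofChoice {hdecl : P.DeclaresDistributions} {W : Finset (TauAtom C Dom)}
    {φ : (k : P.PfConst) → Dom k.const} (hW : P.IsPossibleWorld W) (hφ : Agrees W φ)
    (hprob : ∀ k, P.pfcProb k (φ k) ≠ 0) :
    (P.translation hdecl).toWProgram.IsFull (ofChoice W φ) := by
  obtain ⟨⟨htau, hstab⟩, huniq⟩ := isPossibleWorld_iff.1 hW
  refine MVProgram.isFull_iff.2 ⟨⟨fun a ha hp => ?_,
    satReduct_trRules_iff.2 (trRed_ofChoice htau hφ), uniqueValues_ofChoice huniq,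
    fun c hc => ?_⟩, fun J hJ hred hpf => ?_⟩
  · obtain ⟨k, y, rfl⟩ := trIsProb_iff.1 hp
    have h1 := hprob k
    rw [pfcAtom_mem_ofChoice.1 ha, ← trM_pfcAtom] at h1
    exact h1
  · rcases c with c | x | r | r
    · exact hc.elim
    · exact ⟨_, (pfcAtom_mem_ofChoice (k := .inl x)).2 rfl⟩
    · exact ⟨_, (pfcAtom_mem_ofChoice (k := .inr r)).2 rfl⟩
    · exact hc.elim
  · replace hred : TrRed (ofChoice W φ) J := satReduct_trRules_iff.1 hred
    have hJW : origPart J = W := by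
      refine hstab _ ?_ ?_
      · simpa only [origPart_ofChoice] using origPart_mono hJ
      · simpa only [origPart_ofChoice] using hred.tau
    refine eq_of_atoms (hJW.trans origPart_ofChoice.symm)
      (fun k y => ⟨fun h => hJ h, fun h => hpf _ h (trIsProb_iff.2 ⟨k, y, rfl⟩)⟩)
      fun r => ⟨fun h => hJ h, fun h => ?_⟩
    obtain ⟨x, rfl, h1, h2, h3⟩ := assignedAtom_mem_ofChoice.1 h
    have := hred.assigned x
    rw [hJW, origPart_ofChoice] at this
    exact this h1 h2 h3

/-- Probabilistic constants contribute the declared probabilities of their values. -/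
theorem limWeight_ofChoice {hdecl : P.DeclaresDistributions} {W : Finset (TauAtom C Dom)}
    {φ : (k : P.PfConst) → Dom k.const} (hW : P.IsPossibleWorld W) (hφ : Agrees W φ)
    (hprob : ∀ k, P.pfcProb k (φ k) ≠ 0) :
    (P.translation hdecl).toWProgram.limWeight (ofChoice W φ) = ∏ k, P.pfcProb k (φ k) := by
  rw [MVProgram.limWeight_eq (isFull_ofChoice hW hφ hprob)]
  have e : Finset.univ.filter (fun a : P.TrAtom =>
      (P.translation hdecl).isProb a.1 ∧ a ∈ ofChoice W φ) =
      Finset.univ.image fun k => P.pfcAtom k (φ k) := by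
    ext a
    simp only [Finset.mem_filter, Finset.mem_univ, true_and, Finset.mem_image]
    constructor
    · rintro ⟨hp, ha⟩
      obtain ⟨k, y, rfl⟩ := trIsProb_iff.1 hp
      exact ⟨k, by rw [pfcAtom_mem_ofChoice.1 ha]⟩
    · rintro ⟨k, rfl⟩
      exact ⟨trIsProb_iff.2 ⟨k, _, rfl⟩, pfcAtom_mem_ofChoice.2 rfl⟩
  rw [e, Finset.prod_image fun k _ k' _ h => pfcAtom_injective h]
  exact Finset.prod_congr rfl fun k _ => trM_pfcAtom k (φ k)

end Program

namespace Program

variable {C : Type u} {Dom : C → Type v} {ρ : Type w} [∀ c, Fintype (Dom c)]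
variable {P : Program C Dom ρ} {W : Finset (TauAtom C Dom)}

theorem map_origToTr (F : Formula (Atom C Dom)) :
    F.map P.origToTr = (F.map origAtom).map P.tauToTr := by
  induction F with
  | atom a => rfl
  | falsum => rfl
  | verum => rfl
  | neg F ih => exact congrArg Formula.neg ih
  | and F G ihF ihG => exact congrArg₂ Formula.and ihF ihG
  | or F G ihF ihG => exact congrArg₂ Formula.or ihF ihG

/-! ### Active constants in a possible world -/

theorem causal_empty (c : C) (y : Dom c) :
    causal (∅ : Finset (PrAtom C Dom ρ)) c y = 1 / (Fintype.card (Dom c) : ℝ) := by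
  have e : AV (∅ : Finset (PrAtom C Dom ρ)) c = ∅ := by simp [AV]
  rw [causal, e, if_neg (Finset.notMem_empty y), dp, e, Finset.sum_empty, sub_zero,
    Finset.sdiff_empty, Finset.card_univ]

theorem PfIndex.exists_prAtom (x : P.PfIndex) : ∃ a ∈ P.pr, a.rule = x.rule ∧
    a.atom.1 = (P.sel x.rule).const ∧ a.cond = x.cond ∧
    ¬ ∃ y, (⟨(P.sel x.rule).const, y⟩ : Atom C Dom) ∈ P.act := by
  obtain ⟨a, ha⟩ := x.2
  unfold PRB at ha
  split_ifs at ha with h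
  · exact (Finset.notMem_empty a ha).elim
  · obtain ⟨h1, h2, h3, h4⟩ := Finset.mem_filter.1 ha
    exact ⟨a, h1, h2, h3, h4, h⟩

/-- For each constant that is possible in `W`, some probabilistic constant is active. -/
theorem exists_isActive {c : C} (h : P.Possible W c) :
    ∃ k : P.PfConst, k.const = c ∧ IsActive W k := by
  obtain ⟨r, rfl, hr⟩ := h
  by_cases ha : P.IsAssigned W r
  · obtain ⟨x, rfl, hx⟩ := ha
    exact ⟨.inl x, rfl, hx⟩
  · exact ⟨.inr r, rfl, hr, ha⟩

variable [Fintype C] [Fintype ρ]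

theorem IsPossibleWorld.value_unique (hW : P.IsPossibleWorld W) {c : C} {x y : Dom c}
    (hx : origAtom (⟨c, x⟩ : Atom C Dom) ∈ W) (hy : origAtom (⟨c, y⟩ : Atom C Dom) ∈ W) : x = y :=
  hW.2 (.orig c) x y hx hy

theorem IsPossibleWorld.exists_value (hW : P.IsPossibleWorld W) {r : ρ} (hr : P.Applied W r) :
    ∃ x, origAtom (⟨(P.sel r).const, x⟩ : Atom C Dom) ∈ W := by
  obtain ⟨⟨htau, -⟩, -⟩ := isPossibleWorld_iff.1 hW
  by_cases hi : interveneAtom Dom (P.sel r).const ∈ W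
  · obtain ⟨z, hz⟩ := hW.intervene_iff.1 hi
    exact ⟨z, htau.orig_of_act _ (htau.act _ hz)⟩
  · exact htau.sel r hr hi

/-- For an assigning index `(B, r)`, the condition `B` is the common condition `B_{W,c}` of the
pr-atoms applied in `W`. -/
theorem IsAssigning.prw_eq (hsel : P.UniqueSelection) (hassign : P.UniqueAssignment)
    (hW : P.IsPossibleWorld W) {x : P.PfIndex} (hx : IsAssigning W x) :
    P.PRW W (P.sel x.rule).const = P.PRB x.cond x.rule := by
  obtain ⟨hcond, happ, hi⟩ := hx
  obtain ⟨b, hb, hb1, hb2, hb3, hact⟩ := x.exists_prAtom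
  rw [PRW, if_neg hi, PRB, if_neg hact]
  refine Finset.filter_congr fun a ha => ⟨?_, ?_⟩
  · rintro ⟨h1, h2, h3, h4⟩
    have hr : a.rule = x.rule := hsel W hW _ _ h1 h2 happ
    refine ⟨hr, h3, ?_⟩
    by_cases hab : a = b
    · rw [hab, hb3]
    · rw [← hb3]
      exact (hassign W hW x.rule happ a ha b hb hr hb1 h3 hb2 h4 (by rwa [hb3]) hab).2
  · rintro ⟨h1, h2, h3⟩
    rw [h1, h3]
    exact ⟨rfl, happ, h2, hcond⟩

/-- If a pr-atom is applied in `W`, its condition and its rule form an assigning index. -/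
theorem exists_isAssigning (hsel : P.UniqueSelection) (hW : P.IsPossibleWorld W) {r : ρ}
    (hr : P.Applied W r) {a : PrAtom C Dom ρ} (ha : a ∈ P.PRW W (P.sel r).const) :
    ∃ x : P.PfIndex, x.rule = r ∧ x.cond = a.cond ∧ IsAssigning W x := by
  unfold PRW at ha
  split_ifs at ha with hi
  · exact (Finset.notMem_empty a ha).elim
  · obtain ⟨h1, h2, h3, h4, h5⟩ := Finset.mem_filter.1 ha
    have hra : a.rule = r := hsel W hW _ _ h2 h3 hr
    have hne : (P.PRB a.cond r).Nonempty := by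
      refine ⟨a, ?_⟩
      rw [PRB, if_neg fun h => hi (hW.intervene_iff.2 h)]
      exact Finset.mem_filter.2 ⟨h1, hra, h4, rfl⟩
    exact ⟨⟨(a.cond, r), hne⟩, rfl, rfl, h5, hr, hi⟩

theorem prw_eq_empty_iff (hsel : P.UniqueSelection) (hassign : P.UniqueAssignment)
    (hW : P.IsPossibleWorld W) {r : ρ} (hr : P.Applied W r) :
    P.PRW W (P.sel r).const = ∅ ↔ ¬ P.IsAssigned W r := by
  constructor
  · rintro h ⟨x, rfl, hx⟩
    rw [hx.prw_eq hsel hassign hW] at h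
    exact x.2.ne_empty h
  · intro h
    refine Finset.eq_empty_of_forall_notMem fun a ha => h ?_
    obtain ⟨x, h1, -, h2⟩ := exists_isAssigning hsel hW hr ha
    exact ⟨x, h1, h2⟩

theorem IsActive.pfcProb_eq (hsel : P.UniqueSelection) (hassign : P.UniqueAssignment)
    (hW : P.IsPossibleWorld W) {k : P.PfConst} (hk : IsActive W k) (y : Dom k.const) :
    P.pfcProb k y = causal (P.PRW W k.const) k.const y := by
  rcases k with x | r
  · exact congrArg (fun S => causal S _ y) (hk.prw_eq hsel hassign hW).symm
  · have h : P.PRW W (P.sel r).const = ∅ := (prw_eq_empty_iff hsel hassign hW hk.1).2 hk.2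
    exact ((congrArg (fun S => causal S (P.sel r).const y) h).trans (causal_empty _ y)).symm

/-- At most one probabilistic constant is active for each original constant. -/
theorem IsActive.eq_of_const_eq (hsel : P.UniqueSelection) (hassign : P.UniqueAssignment)
    (hW : P.IsPossibleWorld W) {k k' : P.PfConst} (hk : IsActive W k) (hk' : IsActive W k')
    (h : k.const = k'.const) : k = k' := by
  have hr : k.rule = k'.rule := hsel W hW _ _ h hk.applied hk'.applied
  rcases k with x | r <;> rcases k' with x' | r'
  · have hr' : x.rule = x'.rule := hr
    have e1 := IsAssigning.prw_eq hsel hassign hW hk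
    have e2 := IsAssigning.prw_eq hsel hassign hW hk'
    rw [← hr', e1] at e2
    obtain ⟨a, ha⟩ := x.2
    have hc : ∀ {B r}, a ∈ P.PRB B r → a.cond = B := by
      intro B r ha
      unfold PRB at ha
      split_ifs at ha
      · exact (Finset.notMem_empty a ha).elim
      · exact (Finset.mem_filter.1 ha).2.2.2
    have hc1 : a.cond = x.cond := hc ha
    have ha' : a ∈ P.PRB x.cond x.rule := ha
    have hc2 : a.cond = x'.cond := hc (e2 ▸ ha')
    exact congrArg Sum.inl (Subtype.ext (Prod.ext (hc1.symm.trans hc2) hr'))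
  · exact (hk'.2 ⟨x, hr, hk⟩).elim
  · exact (hk.2 ⟨x', hr.symm, hk'⟩).elim
  · exact congrArg Sum.inr hr

/-! ### Probabilities -/

/-- Summing out the probabilistic constants that are not active leaves the product, over the
constants possible in `W`, of the causal probabilities of their values in `W`. -/
theorem sum_prod_pfcProb [∀ c, Nonempty (Dom c)] (hsel : P.UniqueSelection)
    (hassign : P.UniqueAssignment) (hdecl : P.DeclaresDistributions)
    (hW : P.IsPossibleWorld W) :
    ∑ φ ∈ Finset.univ.filter (fun φ : (k : P.PfConst) → Dom k.const => Agrees W φ),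
      ∏ k, P.pfcProb k (φ k) = P.muHat W := by
  let S : (k : P.PfConst) → Finset (Dom k.const) := fun k =>
    Finset.univ.filter fun y => origAtom (⟨k.const, y⟩ : Atom C Dom) ∈ W
  -- Agreement is a separate condition on each coordinate, so that the sum of products factorizes.
  have e1 : Finset.univ.filter (fun φ : (k : P.PfConst) → Dom k.const => Agrees W φ) =
      Fintype.piFinset fun k => if IsActive W k then S k else Finset.univ := by
    ext φ
    simp only [Finset.mem_filter, Finset.mem_univ, true_and, Fintype.mem_piFinset]
    refine forall_congr' fun k => ?_
    split_ifs with hk <;> simp [hk, S]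
  have hsum : ∀ k : P.PfConst, ∑ y, P.pfcProb k y = 1 := by
    rintro (x | r)
    · exact trM_sum hdecl (.pf x) trivial
    · exact trM_sum hdecl (.pfDefault r) trivial
  have e2 : ∀ k : P.PfConst, ∑ y ∈ (if IsActive W k then S k else Finset.univ), P.pfcProb k y =
      if IsActive W k then ∏ y ∈ S k, causal (P.PRW W k.const) k.const y else 1 := by
    intro k
    split_ifs with hk
    · obtain ⟨x, hx⟩ := hW.exists_value hk.applied
      have : S k = {x} := by
        ext y
        simp only [S, Finset.mem_filter, Finset.mem_univ, true_and, Finset.mem_singleton]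
        exact ⟨fun hy => hW.value_unique hy hx, fun hy => hy ▸ hx⟩
      rw [this, Finset.sum_singleton, Finset.prod_singleton, hk.pfcProb_eq hsel hassign hW]
    · exact hsum k
  rw [e1, ← Finset.prod_univ_sum, Finset.prod_congr rfl fun k _ => e2 k, ← Finset.prod_filter,
    Finset.prod_sigma', muHat]
  refine Finset.prod_bij (fun t _ => ⟨t.1.const, t.2⟩) ?_ ?_ ?_ fun _ _ => rfl
  · intro t ht
    simp only [S, Finset.mem_sigma, Finset.mem_filter, Finset.mem_univ, true_and] at ht ⊢
    exact ⟨ht.2, t.1.rule, rfl, ht.1.applied⟩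
  · rintro ⟨k, y⟩ ht ⟨k', y'⟩ ht' h
    simp only [S, Finset.mem_sigma, Finset.mem_filter, Finset.mem_univ, true_and] at ht ht'
    obtain rfl := ht.1.eq_of_const_eq hsel hassign hW ht'.1 (congrArg Sigma.fst h)
    rw [hW.value_unique ht.2 ht'.2]
  · rintro ⟨c, y⟩ ha
    simp only [Finset.mem_filter, Finset.mem_univ, true_and] at ha
    obtain ⟨k, rfl, hk⟩ := exists_isActive ha.2
    exact ⟨⟨k, y⟩, by simpa [S] using ⟨hk, ha.1⟩, rfl⟩

/-- The full stable models that extend `W` have total weight `muHat W`: they correspond to the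
choices `φ` that agree with `W` and have non-zero probability. -/
theorem sum_limWeight_origPart_eq [∀ c, Nonempty (Dom c)] (hsel : P.UniqueSelection)
    (hassign : P.UniqueAssignment) (hdecl : P.DeclaresDistributions)
    (hW : P.IsPossibleWorld W) :
    ∑ I ∈ Finset.univ.filter (fun I : Finset P.TrAtom => origPart I = W),
      (P.translation hdecl).toWProgram.limWeight I = P.muHat W := by
  rw [← sum_prod_pfcProb hsel hassign hdecl hW]
  symm
  refine Finset.sum_bij_ne_zero (fun φ _ _ => ofChoice W φ) ?_ ?_ ?_ ?_
  · exact fun φ _ _ => Finset.mem_filter.2 ⟨Finset.mem_univ _, origPart_ofChoice⟩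
  · exact fun φ _ _ ψ _ _ h => ofChoice_injective W h
  · intro I hI hne
    have hfull : (P.translation hdecl).toWProgram.IsFull I := by
      by_contra h
      exact hne (if_neg h)
    obtain ⟨V, φ, hV, hφ, hp, rfl⟩ := exists_of_isFull hfull
    rw [Finset.mem_filter, origPart_ofChoice] at hI
    obtain rfl := hI.2
    exact ⟨φ, Finset.mem_filter.2 ⟨Finset.mem_univ _, hφ⟩,
      Finset.prod_ne_zero_iff.2 fun k _ => hp k, rfl⟩
  · intro φ hφ hne
    exact (limWeight_ofChoice hW (Finset.mem_filter.1 hφ).2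
      fun k => Finset.prod_ne_zero_iff.1 hne k (Finset.mem_univ k)).symm

/-- The probability under the translation of a formula that, in the full stable models, depends
only on the original part. -/
theorem translation_probOf_eq [∀ c, Nonempty (Dom c)] (hsel : P.UniqueSelection)
    (hassign : P.UniqueAssignment) (hdecl : P.DeclaresDistributions)
    (hpos : ∃ W, P.IsPossibleWorld W ∧ P.muHat W ≠ 0)
    (F : Formula P.TrAtom) (G : Finset (TauAtom C Dom) → Prop)
    (hFG : ∀ W φ, P.IsPossibleWorld W → Agrees W φ → (F.Sat (ofChoice W φ) ↔ G W)) :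
    (P.translation hdecl).probOf F =
      ∑ W ∈ Finset.univ.filter (fun W => P.IsPossibleWorld W ∧ G W), P.mu W := by
  set Q := (P.translation hdecl).toWProgram with hQ
  have hzero : ∀ I, ¬ Q.IsFull I → Q.limWeight I = 0 := fun I h => if_neg h
  have hex : ∃ I, Q.IsFull I := by
    obtain ⟨W, hW, hne⟩ := hpos
    by_contra! h
    rw [← sum_limWeight_origPart_eq hsel hassign hdecl hW] at hne
    exact hne (Finset.sum_eq_zero fun I _ => hzero I (h I))
  -- Grouping by original parts; applied below to `F` and, for the normalizing constant, to `True`.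
  have hfib : ∀ (F : Finset P.TrAtom → Prop) (G : Finset (TauAtom C Dom) → Prop),
      (∀ W φ, P.IsPossibleWorld W → Agrees W φ → (F (ofChoice W φ) ↔ G W)) →
      ∑ I ∈ Finset.univ.filter (fun I => F I), Q.limWeight I =
        ∑ W ∈ Finset.univ.filter (fun W => P.IsPossibleWorld W ∧ G W), P.muHat W := by
    intro F G hFG
    have hsub : Finset.univ.filter (fun I => F I ∧ Q.IsFull I) ⊆
        Finset.univ.filter (fun I => F I) := Finset.monotone_filter_right _ fun _ _ h => h.1
    rw [← Finset.sum_subset hsub fun I hI hI' => hzero I fun h => hI' (by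
      simp only [Finset.mem_filter, Finset.mem_univ, true_and] at hI ⊢
      exact ⟨hI, h⟩)]
    rw [← Finset.sum_fiberwise_of_maps_to (g := origPart)
      (t := Finset.univ.filter (fun W => P.IsPossibleWorld W ∧ G W))]
    · refine Finset.sum_congr rfl fun W hW => ?_
      obtain ⟨-, hW, hG⟩ := Finset.mem_filter.1 hW
      rw [← sum_limWeight_origPart_eq hsel hassign hdecl hW, Finset.filter_filter]
      refine Finset.sum_subset (Finset.monotone_filter_right _ fun _ _ h => h.2)
        fun I hI hI' => hzero I fun h => hI' ?_
      obtain ⟨V, φ, hV, hφ, hp, rfl⟩ := exists_of_isFull h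
      rw [Finset.mem_filter, origPart_ofChoice] at hI
      obtain rfl := hI.2
      exact Finset.mem_filter.2 ⟨Finset.mem_univ _, ⟨(hFG V φ hV hφ).2 hG, h⟩, origPart_ofChoice⟩
    · intro I hI
      obtain ⟨-, hF, h⟩ := Finset.mem_filter.1 hI
      obtain ⟨V, φ, hV, hφ, hp, rfl⟩ := exists_of_isFull h
      rw [origPart_ofChoice]
      exact Finset.mem_filter.2 ⟨Finset.mem_univ _, hV, (hFG V φ hV hφ).1 hF⟩
  have htotal := hfib (fun _ => True) (fun _ => True) fun _ _ _ _ => Iff.rfl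
  simp only [Finset.filter_true, and_true] at htotal
  rw [MVProgram.probOf, WProgram.probOf, ← hQ,
    Finset.sum_congr rfl fun I _ => Q.prob_eq hex I, ← Finset.sum_div, htotal,
    hfib (fun I => F.Sat I) G hFG, Finset.sum_div]
  rfl

/-- As possible worlds form an antichain, a full stable model whose original part contains `W` has
original part `W`; the remaining conjuncts of `F_W` then hold because the active constants agree
with `W`. -/
theorem sat_worldFormula (hsel : P.UniqueSelection) (hassign : P.UniqueAssignment)
    {W V : Finset (TauAtom C Dom)} {φ : (k : P.PfConst) → Dom k.const}
    (hW : P.IsPossibleWorld W) (hV : P.IsPossibleWorld V) (hφ : Agrees V φ) :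
    (P.worldFormula W).Sat (ofChoice V φ) ↔ V = W := by
  simp only [worldFormula, Formula.Sat, Formula.sat_conj, tauToTr_mem_ofChoice]
  constructor
  · rintro ⟨h, -⟩
    exact (hW.eq_of_subset hV h).symm
  · rintro rfl
    refine ⟨fun a ha => ha, fun t ht => ?_, fun t ht => ?_⟩
    · obtain ⟨-, h1, h2, a, ha, h3⟩ := Finset.mem_filter.1 ht
      obtain ⟨x, hx1, hx2, hx⟩ := exists_isAssigning hsel hV h2 ha
      obtain rfl : x = t.1 := Subtype.ext (Prod.ext (hx2.trans h3) hx1)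
      exact (pfcAtom_mem_ofChoice (k := .inl t.1)).2 (hV.value_unique (hφ (.inl t.1) hx) h1)
    · obtain ⟨-, h1, h2, h3⟩ := Finset.mem_filter.1 ht
      exact (pfcAtom_mem_ofChoice (k := .inr t.1)).2 (hV.value_unique
        (hφ (.inr t.1) ⟨h2, (prw_eq_empty_iff hsel hassign hV h2).1 h3⟩) h1)

end Program

end

end PLog

theorem mainTheorem2 {C : Type u} {Dom : C → Type v} {ρ : Type w}
    [Fintype C] [∀ c, Fintype (Dom c)] [∀ c, Nonempty (Dom c)] [Fintype ρ]
    (P : PLog.Program C Dom ρ)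
    (hsel : P.UniqueSelection) (hassign : P.UniqueAssignment)
    (hdecl : P.DeclaresDistributions)
    (hcons : P.Consistent) (hpos : ∃ W, P.IsPossibleWorld W ∧ P.muHat W ≠ 0) :
    (∀ W, P.IsPossibleWorld W →
      P.mu W = (P.translation hdecl).probOf (P.worldFormula W)) ∧
    ∀ A : LPMLN.Formula (LPMLN.Atom C Dom),
      P.probOf A = (P.translation hdecl).probOf (A.map P.origToTr) := by
  refine ⟨fun W hW => ?_, fun A => ?_⟩
  · rw [PLog.Program.translation_probOf_eq hsel hassign hdecl hpos _ (fun V => V = W)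
      fun V φ hV hφ => PLog.Program.sat_worldFormula hsel hassign hW hV hφ]
    refine (Finset.sum_eq_single_of_mem W ?_ ?_).symm
    · simp only [Finset.mem_filter, Finset.mem_univ, hW, and_self]
    · intro V hV hne
      simp only [Finset.mem_filter] at hV
      exact (hne hV.2.2).elim
  · rw [PLog.Program.translation_probOf_eq hsel hassign hdecl hpos _
      (fun V => (A.map PLog.origAtom).Sat V) fun V φ _ _ => ?_]
    · rfl
    · rw [PLog.Program.map_origToTr, PLog.Program.sat_map_tauToTr,
        PLog.Program.origPart_ofChoice]
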